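/- All graphs are finite multigraphs. A \emph{graft} $(G,T)$ is a graph $G$ with a set $T\subseteq V(G)$ such that every connected component of $G$ contains an even number of vertices of $T$. A \emph{join} of $(G,T)$ is a set $F\subseteq E(G)$ such that the number of edges of $F$ joining $v$ to other vertices is odd for $v\in T$ and even for $v\in V(G)\setminus T$; a \emph{minimum join} is a join with the fewest edges, and $\nu(G,T)$ denotes the number of its edges. An edge is \emph{allowed} if it lies in some minimum join; two vertices are \emph{factor-connected} if they are joined by a path of allowed edges of $(G,T)$. The \emph{factor-components} of $(G,T)$ are its maximal nonempty subgrafts $(H,T\cap V(H))$ any two vertices of which are factor-connected in $(G,T)$, and $\mathcal{G}(G,T)$ denotes the set of factor-components. A set $X\subseteq V(G)$ is \emph{separating} if it is a union of vertex sets of factor-components; then $(G,T)[X]$ denotes the graft $(G[X],T\cap X)$. For $Y\subseteq V(G)$, the contraction $(G,T)/Y$ is obtained by identifying $Y$ to a single vertex $y$ and deleting the edges with both ends in $Y$; its terminal set is $T\setminus Y$, together with $y$ if $|T\cap Y|$ is odd. Let $(G,T;A,B)$ denote a graft $(G,T)$ with $G$ bipartite with color classes $A,B$ (an ordered pair). It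 is a \emph{comb} if $B\subseteq T$ and $\nu(G,T)=|B|$. It is a \emph{quasicomb} with spine set $A$ and tooth set $B$ if $\nu(G,T)=|B\cap T|$. A quasicomb is \emph{critical} with root $r\in B$ if $\nu(G,T\mathbin{\Delta}\{x,r\})-\nu(G,T)=1$ for every $x\in A$ and $\nu(G,T\mathbin{\Delta}\{x,r\})-\nu(G,T)=0$ for every $x\in B\setminus\{r\}$ (in particular all these joins exist). Let $(G,T;A,B)$ be a comb and $G_0\in\mathcal{G}(G,T)$. A set $X\subseteq V(G)$ is a \emph{critical set} for $G_0$ if $X$ is separating, $V(G_0)\subseteq X$, and $(G,T)[X]/V(G_0)$ is a critical quasicomb whose root is the contracted vertex $g_0$, with spine set $(A\cap X)\setminus V(G_0)$ and tooth set $((B\cap X)\setminus V(G_0))\cup\{g_0\}$. For $G_1,G_2\in\mathcal{G}(G,T)$, write $G_1\preceq G_2$ if there is a critical set $X$ for $G_1$ with $V(G_2)\subseteq X$. \textbf{Theorem.} For every comb $(G,T;A,B)$, the relation $\preceq$ is a partial order on $\mathcal{G}(G,T)$. -/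

import Mathlib

open scoped Graph symmDiff

noncomputable section

namespace Graft

variable {α β : Type*}

/-- The cut `δ_G(X)`: the edges of the multigraph `G` between `X` and `V(G) \ X`. -/
def edgeCut (G : Graph α β) (X : Set α) : Set β :=
  {e | ∃ x ∈ X, ∃ y ∈ V(G) \ X, G.IsLink e x y}

/-- `u` and `v` are vertices of `G` joined by a path of `G` all of whose edges lie in `D`
(equivalently, by a walk with this property). -/
def PathJoined (G : Graph α β) (D : Set β) (u v : α) : Prop :=
  u ∈ V(G) ∧ v ∈ V(G) ∧ Relation.ReflTransGen (fun x y => ∃ e ∈ D, G.IsLink e x y) u v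

/-- `(G, T)` is a graft: `T` is a set of vertices, and every connected component of `G`
contains an even number of elements of `T`. -/
def IsGraft (G : Graph α β) (T : Set α) : Prop :=
  T ⊆ V(G) ∧ ∀ v ∈ V(G), Even ({u | PathJoined G E(G) v u} ∩ T).ncard

/-- `F` is a join of `(G, T)` (a `T`-join of `G`). -/
def IsJoin (G : Graph α β) (T : Set α) (F : Set β) : Prop :=
  F ⊆ E(G) ∧ ∀ v ∈ V(G), Odd (edgeCut G {v} ∩ F).ncard ↔ v ∈ T

/-- A minimum join: a join with the minimum number of edges. -/
def IsMinJoin (G : Graph α β) (T : Set α) (F : Set β) : Prop :=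
  IsJoin G T F ∧ ∀ F' : Set β, IsJoin G T F' → F.encard ≤ F'.encard

/-- `ν(G, T)`: the number of edges in a minimum join (`⊤` exactly when there is no finite join). -/
def nu (G : Graph α β) (T : Set α) : ℕ∞ :=
  ⨅ (F : Set β) (_ : IsJoin G T F), F.encard

/-- An edge is allowed if some minimum join contains it. -/
def allowedEdges (G : Graph α β) (T : Set α) : Set β :=
  {e | ∃ F : Set β, IsMinJoin G T F ∧ e ∈ F}

/-- Two vertices are factor-connected if they are joined by a path of allowed edges. -/
def FactorConnected (G : Graph α β) (T : Set α) (u v : α) : Prop :=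
  PathJoined G (allowedEdges G T) u v

/-- `H` (with `T ∩ V(H)`) is a nonempty subgraft of `(G, T)` any two of whose vertices are
factor-connected in `(G, T)`. -/
def IsFactorConnectedSubgraft (G : Graph α β) (T : Set α) (H : Graph α β) : Prop :=
  H ≤ G ∧ V(H).Nonempty ∧ IsGraft H (T ∩ V(H)) ∧
    ∀ u ∈ V(H), ∀ v ∈ V(H), FactorConnected G T u v

/-- The set of factor-components of `(G, T)`: its maximal factor-connected subgrafts. -/
def factorComponents (G : Graph α β) (T : Set α) : Set (Graph α β) :=
  {H | Maximal (IsFactorConnectedSubgraft G T) H}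

/-- A set of vertices is separating if it is a union of vertex sets of factor-components. -/
def IsSeparating (G : Graph α β) (T : Set α) (X : Set α) : Prop :=
  ∃ 𝓗 : Set (Graph α β), 𝓗 ⊆ factorComponents G T ∧ X = ⋃ H ∈ 𝓗, V(H)

/-- `G` is bipartite with color classes `A` and `B`. -/
def HasColorClasses (G : Graph α β) (A B : Set α) : Prop :=
  A ∪ B = V(G) ∧ Disjoint A B ∧
    ∀ e x y, G.IsLink e x y → (x ∈ A ∧ y ∈ B) ∨ (x ∈ B ∧ y ∈ A)

/-- `(G, T; A, B)` is a bipartite graft with an ordered bipartition. -/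
def IsBipartiteGraft (G : Graph α β) (T A B : Set α) : Prop :=
  IsGraft G T ∧ HasColorClasses G A B

/-- `(G, T; A, B)` is a comb with spine set `A` and tooth set `B`. -/
def IsComb (G : Graph α β) (T A B : Set α) : Prop :=
  IsBipartiteGraft G T A B ∧ B ⊆ T ∧ nu G T = B.encard

/-- `(G, T; A, B)` is a quasicomb with spine set `A` and tooth set `B`. -/
def IsQuasicomb (G : Graph α β) (T A B : Set α) : Prop :=
  IsBipartiteGraft G T A B ∧ nu G T = (B ∩ T).encard

/-- `(G, T; A, B)` is a critical quasicomb with root `r ∈ B`: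
`ν(G, T ∆ {x, r}) - ν(G, T)` is `1` for every `x ∈ A` and `0` for every `x ∈ B`
(the case `x = r`, where `T ∆ {x} ∆ {r}` is `T`, being trivial). -/
def IsCriticalQuasicomb (G : Graph α β) (T A B : Set α) (r : α) : Prop :=
  IsQuasicomb G T A B ∧ r ∈ B ∧
    (∀ x ∈ A, nu G (T ∆ {x, r}) = nu G T + 1) ∧
    ∀ x ∈ B, x ≠ r → nu G (T ∆ {x, r}) = nu G T

open Classical in
/-- The map collapsing `X` to the single new vertex `none`. -/
def collapse (X : Set α) (v : α) : Option α :=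
  if v ∈ X then none else some v

/-- The contraction `G / X`: the vertices of `X` are identified to one vertex `none`, and the edges
with both ends in `X` are removed (other edges, including parallel ones, are kept). -/
def contract (G : Graph α β) (X : Set α) : Graph (Option α) β :=
  (G.deleteEdges E(G.induce X)).map (collapse X)

/-- The terminal set of the contraction `(G, T) / X`: `T \ X`, together with the contracted
vertex if `|X ∩ T|` is odd. -/
def contractTerminals (T X : Set α) : Set (Option α) :=
  some '' (T \ X) ∪ {g | g = none ∧ Odd (X ∩ T).ncard}

/-- `X` is a critical set for the factor-component `G₀` of the comb `(G, T; A, B)`: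
`X` is separating, contains `V(G₀)`, and `(G, T)[X] / G₀` is a critical quasicomb whose root
is the contracted vertex, with spine set `(A ∩ X) \ V(G₀)` and tooth set
`((B ∩ X) \ V(G₀)) ∪ {root}`. -/
def IsCriticalSet (G : Graph α β) (T A B : Set α) (G₀ : Graph α β) (X : Set α) : Prop :=
  IsSeparating G T X ∧ V(G₀) ⊆ X ∧
    IsCriticalQuasicomb (contract (G.induce X) V(G₀)) (contractTerminals (T ∩ X) V(G₀))
      (some '' ((A ∩ X) \ V(G₀))) (insert none (some '' ((B ∩ X) \ V(G₀)))) none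

/-- The relation `G₁ ⪯ G₂`: some critical set for `G₁` contains `V(G₂)`. -/
def CathedralLE (G : Graph α β) (T A B : Set α) (G₁ G₂ : Graph α β) : Prop :=
  ∃ X : Set α, IsCriticalSet G T A B G₁ X ∧ V(G₂) ⊆ X

end Graft

end

/-! In a comb every tooth is terminal, so a join has an edge at each tooth, and ν = |B| forces a
minimum join to have exactly one. Up to parallel edges, a minimum join is thus a choice of a spine
neighbor for each tooth that hits a spine vertex an odd number of times exactly when it is terminal.
A state relaxes this: teeth may stay unassigned and parities may fail, and the vector `z` over `ZMod
2` records where. Call u and v removable together in U if U has a state with `z = pt u + pt v`.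

Given two states, the pairs of their values at each tooth are the edges of a graph whose odd-degree
vertices form the support of `z₁ + z₂`. Swapping the states along a path of this graph gives the
simultaneous exchange `Feas.exchange`. The other tools are cutting a state at the border of a subset
(`Feas.exit`), gluing two states by an edge (`Feas.link`), and the remark that a tooth and an
adjacent spine vertex removable together in a closed set form an allowed pair, hence lie in one
class (`IsClosedUnder.allowedPair_of_feas`). Classes are the vertex sets of factor-components. By
exchange, a tooth and a spine vertex of one class, or two spine vertices of it, are always removable
together.

In these terms X is critical for C when no spine vertex of C sees a tooth of X \ C and each v in X \
C is removable in X \ C together with some neighbor of a tooth of C.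

Transitivity: if X is critical for C₁ and contains C₂, and Y is critical for C₂, then X ∪ Y is
critical for C₁ (`IsCriticalFor.union`). From a vertex of Y \ X one follows a state of Y until it
enters X, and continues with a state of X; entering C₁ at a spine vertex would create an allowed
pair across classes.

Antisymmetry: if each of two classes lies in a critical set of the other, the same union is critical
for both, and `IsCriticalFor.class_unique` excludes this for distinct classes. Let D be the
component of K \ C₁ containing C₂. The teeth of C₁ adjacent to D are pairwise not removable together
in K \ D (`IsClass.contacts_equiv`). Criticality for C₂, started at one such tooth, yields a second
one removable together with it, a contradiction. -/

namespace Graft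

/-! ### States and their simultaneous exchange property. -/

section States

open scoped Classical

variable {α : Type*}

/-- The characteristic vector of a single vertex. -/
noncomputable def pt (v : α) : α → ZMod 2 := fun w => if w = v then 1 else 0

@[simp] lemma pt_self (v : α) : pt v v = 1 := by simp [pt]

lemma pt_of_ne {v w : α} (h : w ≠ v) : pt v w = 0 := by simp [pt, h]

lemma pt_ne_zero {v w : α} : pt v w ≠ 0 ↔ w = v := by
  by_cases h : w = v <;> simp [pt, h]

lemma vec_two : (2 : α → ZMod 2) = 0 := by
  funext x; exact CharTwo.two_eq_zero

lemma vec_add_self (z : α → ZMod 2) : z + z = 0 := by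
  linear_combination z * (vec_two (α := α))

lemma zmod_ne_zero {x : ZMod 2} : x ≠ 0 ↔ x = 1 := by
  revert x; decide

/-- A family of pairs of points with sum `z` contains a subfamily whose sum consists of a given
point of the support of `z` and another point of the support. -/
lemma exists_subfamily_sum_eq {ι : Type*} (S : Finset ι) (s t : ι → α) {z : α → ZMod 2}
    (h : ∑ i ∈ S, (pt (s i) + pt (t i)) = z) {u : α} (hu : z u ≠ 0) :
    ∃ v, v ≠ u ∧ z v ≠ 0 ∧ ∃ P ⊆ S, ∑ i ∈ P, (pt (s i) + pt (t i)) = pt u + pt v := by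
  by_contra! hcon
  -- With the pairs as edges, `C` is the component of `u`. If `u` were its only support point,
  -- summing `z` over the relevant finite part `K` of `C` would give `z u`, while every pair
  -- contributes 0, both its ends being in `C` or neither.
  set C : Set α := {v | ∃ P ⊆ S, ∑ i ∈ P, (pt (s i) + pt (t i)) = pt u + pt v} with hC
  have step : ∀ i ∈ S, ∀ v w, v ∈ C → pt (s i) + pt (t i) = pt v + pt w → w ∈ C := by
    rintro i hi v w ⟨P, hP, hs⟩ hvw
    by_cases hiP : i ∈ P
    · refine ⟨P.erase i, (Finset.erase_subset _ _).trans hP, ?_⟩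
      have := Finset.sum_erase_add P (fun i => pt (s i) + pt (t i)) hiP
      rw [hs, hvw] at this
      linear_combination this - pt w * (vec_two (α := α))
    · refine ⟨insert i P, Finset.insert_subset hi hP, ?_⟩
      rw [Finset.sum_insert hiP, hs, hvw]
      linear_combination pt v * (vec_two (α := α))
  have huC : u ∈ C := ⟨∅, by simp, by simp [vec_add_self]⟩
  have hz : ∀ v ∈ C, v ≠ u → z v = 0 := by
    rintro v ⟨P, hP, hs⟩ hv
    by_contra hzv
    exact hcon v hv hzv P hP hs
  have hst : ∀ i ∈ S, (s i ∈ C ↔ t i ∈ C) := fun i hi =>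
    ⟨fun hh => step i hi _ _ hh rfl, fun hh => step i hi _ _ hh (add_comm _ _)⟩
  set K : Finset α := (insert u (S.image s ∪ S.image t)).filter (· ∈ C) with hK
  have e1 : ∑ v ∈ K, z v = z u := by
    rw [Finset.sum_eq_single u]
    · intro v hv hvu
      exact hz v (Finset.mem_filter.1 hv).2 hvu
    · intro hnot
      exact absurd (Finset.mem_filter.2 ⟨Finset.mem_insert_self _ _, huC⟩) hnot
  have e2 : ∑ v ∈ K, z v = 0 := by
    rw [← h]
    simp only [Finset.sum_apply, Pi.add_apply]
    rw [Finset.sum_comm]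
    refine Finset.sum_eq_zero fun i hi => ?_
    rw [Finset.sum_add_distrib]
    simp only [pt, Finset.sum_ite_eq']
    have hs : s i ∈ K ↔ s i ∈ C := by
      simp only [hK, Finset.mem_filter, Finset.mem_insert, Finset.mem_union, Finset.mem_image]
      exact ⟨fun h => h.2, fun h => ⟨Or.inr (Or.inl ⟨i, hi, rfl⟩), h⟩⟩
    have ht : t i ∈ K ↔ t i ∈ C := by
      simp only [hK, Finset.mem_filter, Finset.mem_insert, Finset.mem_union, Finset.mem_image]
      exact ⟨fun h => h.2, fun h => ⟨Or.inr (Or.inr ⟨i, hi, rfl⟩), h⟩⟩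
    have hst' : s i ∈ K ↔ t i ∈ K := hs.trans ((hst i hi).trans ht.symm)
    by_cases hsK : s i ∈ K
    · simp only [hsK, hst'.1 hsK, if_true]; decide
    · simp only [hsK, mt hst'.2 hsK, if_false]; decide
  exact hu (e1.symm.trans e2)

/-- `f` sends every tooth of `U` to itself or to an adjacent spine vertex of `U`, and the sum of
the images is the set of terminals among the spine vertices of `U`, modified by `z`. -/
def IsState (N : α → α → Prop) (A B T : Set α) (U : Finset α) (f : α → α) (z : α → ZMod 2) :
    Prop :=
  (∀ b ∈ U, b ∈ B → f b = b ∨ (f b ∈ U ∧ f b ∈ A ∧ N b (f b))) ∧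
    ∑ b ∈ U with b ∈ B, pt (f b) = Set.indicator (A ∩ T ∩ U) 1 + z

/-- There is a state of `U` with modification `z`. -/
def Feas (N : α → α → Prop) (A B T : Set α) (U : Finset α) (z : α → ZMod 2) : Prop :=
  ∃ f, IsState N A B T U f z

variable {N : α → α → Prop} {A B T : Set α} {U W : Finset α} {z z₁ z₂ : α → ZMod 2}

lemma Feas.congr (h : Feas N A B T U z₁) (e : z₁ = z₂) : Feas N A B T U z₂ := e ▸ h

/-- The simultaneous exchange property of states. -/
lemma Feas.exchange (h₁ : Feas N A B T U z₁) (h₂ : Feas N A B T U z₂) {u : α}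
    (hu : z₁ u ≠ z₂ u) :
    ∃ v, v ≠ u ∧ z₁ v ≠ z₂ v ∧ Feas N A B T U (z₁ + pt u + pt v) ∧
      Feas N A B T U (z₂ + pt u + pt v) := by
  obtain ⟨f₁, hf₁, hs₁⟩ := h₁
  obtain ⟨f₂, hf₂, hs₂⟩ := h₂
  have hsum : ∑ b ∈ U with b ∈ B, (pt (f₁ b) + pt (f₂ b)) = z₁ + z₂ := by
    rw [Finset.sum_add_distrib, hs₁, hs₂]
    linear_combination Set.indicator (A ∩ T ∩ (U : Set α)) 1 * (vec_two (α := α))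
  have key : ∀ v, (z₁ + z₂) v ≠ 0 ↔ z₁ v ≠ z₂ v := by
    intro v
    rw [Pi.add_apply, not_iff_not]
    generalize z₁ v = x
    generalize z₂ v = y
    revert x y; decide
  obtain ⟨v, hvu, hv, P, hP, hPs⟩ := exists_subfamily_sum_eq _ f₁ f₂ hsum ((key u).2 hu)
  -- Swapping the values on `P` changes either sum by the same vector, as signs do not matter modulo
  -- 2; hence one `P` serves both states.
  have swap : ∀ g₁ g₂ : α → α,
      ∑ b ∈ U with b ∈ B, pt (if b ∈ P then g₂ b else g₁ b) =
        ∑ b ∈ U with b ∈ B, pt (g₁ b) + ∑ b ∈ P, (pt (g₁ b) + pt (g₂ b)) := by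
    intro g₁ g₂
    rw [← Finset.inter_eq_right.2 hP, ← Finset.sum_ite_mem, ← Finset.sum_add_distrib]
    refine Finset.sum_congr rfl fun b hb => ?_
    simp only [Finset.mem_inter, hb, true_and]
    split_ifs
    · linear_combination -pt (g₁ b) * (vec_two (α := α))
    · simp
  refine ⟨v, hvu, (key v).1 hv, ⟨fun b => if b ∈ P then f₂ b else f₁ b, ?_, ?_⟩,
    ⟨fun b => if b ∈ P then f₁ b else f₂ b, ?_, ?_⟩⟩
  · intro b hb hB
    dsimp only
    split_ifs
    · exact hf₂ b hb hB
    · exact hf₁ b hb hB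
  · rw [swap, hs₁, hPs]; ring
  · intro b hb hB
    dsimp only
    split_ifs
    · exact hf₁ b hb hB
    · exact hf₂ b hb hB
  · rw [swap, hs₂]
    simp_rw [add_comm (pt (f₂ _))]
    rw [hPs]; ring

/-- An assigned tooth has its value in `A`, so the coordinate of the sum at `b` only sees the term
of `b` itself. -/
lemma IsState.apply_tooth (hAB : Disjoint A B) {f : α → α} (h : IsState N A B T U f z) {b : α}
    (hb : b ∈ U) (hB : b ∈ B) : z b = 1 ↔ f b = b := by
  have h2 := congrFun h.2 b
  have hA : b ∉ A := fun hA => Set.disjoint_left.1 hAB hA hB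
  rw [Finset.sum_apply, Pi.add_apply, Set.indicator_of_notMem (by simp [hA]), zero_add,
    Finset.sum_eq_single b] at h2
  · rw [← h2]
    by_cases hfb : f b = b
    · simp [hfb]
    · simp [hfb, pt_of_ne (Ne.symm hfb)]
  · intro c hc hcb
    rw [Finset.mem_filter] at hc
    refine pt_of_ne ?_
    rintro rfl
    rcases h.1 c hc.1 hc.2 with h' | h'
    · exact hcb h'.symm
    · exact hA h'.2.1
  · intro hnot
    exact absurd (Finset.mem_filter.2 ⟨hb, hB⟩) hnot

/-- Assigning an unassigned tooth. -/
lemma IsState.assign (hAB : Disjoint A B) {f : α → α} (h : IsState N A B T U f z) {a b : α}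
    (hb : b ∈ U) (hB : b ∈ B) (hz : z b = 1) (ha : a ∈ U) (haA : a ∈ A) (hN : N b a) :
    IsState N A B T U (Function.update f b a) (z + pt a + pt b) := by
  refine ⟨fun c hc hcB => ?_, ?_⟩
  · by_cases hcb : c = b
    · subst hcb
      simp [ha, haA, hN]
    · simpa [hcb] using h.1 c hc hcB
  · have hbU : b ∈ U.filter (· ∈ B) := Finset.mem_filter.2 ⟨hb, hB⟩
    have h2 := h.2
    rw [← Finset.sum_erase_add _ _ hbU] at h2 ⊢
    rw [(h.apply_tooth hAB hb hB).1 hz] at h2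
    rw [Function.update_self]
    rw [Finset.sum_congr rfl (fun c hc => by
      rw [Function.update_of_ne (Finset.ne_of_mem_erase hc)] : ∀ c ∈ (U.filter (· ∈ B)).erase b,
        pt (Function.update f b a c) = pt (f c))]
    linear_combination h2 - pt b * (vec_two (α := α))

lemma Feas.assign (hAB : Disjoint A B) (h : Feas N A B T U z) {a b : α}
    (hb : b ∈ U) (hB : b ∈ B) (hz : z b = 1) (ha : a ∈ U) (haA : a ∈ A) (hN : N b a) :
    Feas N A B T U (z + pt a + pt b) :=
  let ⟨_, hf⟩ := h
  ⟨_, hf.assign hAB hb hB hz ha haA hN⟩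

/-- Unassigning a tooth. -/
lemma IsState.unassign {f : α → α} (h : IsState N A B T U f z) {b : α}
    (hb : b ∈ U) (hB : b ∈ B) :
    IsState N A B T U (Function.update f b b) (z + pt (f b) + pt b) := by
  refine ⟨fun c hc hcB => ?_, ?_⟩
  · by_cases hcb : c = b
    · subst hcb
      simp
    · simpa [hcb] using h.1 c hc hcB
  · have hbU : b ∈ U.filter (· ∈ B) := Finset.mem_filter.2 ⟨hb, hB⟩
    have h2 := h.2
    rw [← Finset.sum_erase_add _ _ hbU] at h2 ⊢
    rw [Function.update_self]
    rw [Finset.sum_congr rfl (fun c hc => by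
      rw [Function.update_of_ne (Finset.ne_of_mem_erase hc)] : ∀ c ∈ (U.filter (· ∈ B)).erase b,
        pt (Function.update f b b c) = pt (f c))]
    linear_combination h2 - pt (f b) * (vec_two (α := α))

/-- States of disjoint sets can be combined. -/
lemma IsState.union (hUW : Disjoint U W) {f g : α → α} (h₁ : IsState N A B T U f z₁)
    (h₂ : IsState N A B T W g z₂) :
    IsState N A B T (U ∪ W) (fun v => if v ∈ U then f v else g v) (z₁ + z₂) := by
  refine ⟨fun b hb hB => ?_, ?_⟩
  · dsimp only
    split_ifs with hbU
    · rcases h₁.1 b hbU hB with h | h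
      · exact Or.inl h
      · exact Or.inr ⟨Finset.mem_union_left _ h.1, h.2⟩
    · have hbW := (Finset.mem_union.1 hb).resolve_left hbU
      rcases h₂.1 b hbW hB with h | h
      · exact Or.inl h
      · exact Or.inr ⟨Finset.mem_union_right _ h.1, h.2⟩
  · rw [Finset.filter_union, Finset.sum_union (Finset.disjoint_filter_filter hUW)]
    have e1 : ∑ b ∈ U with b ∈ B, pt (if b ∈ U then f b else g b) = ∑ b ∈ U with b ∈ B, pt (f b) :=
      Finset.sum_congr rfl fun b hb => by rw [if_pos (Finset.mem_filter.1 hb).1]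
    have e2 : ∑ b ∈ W with b ∈ B, pt (if b ∈ U then f b else g b) = ∑ b ∈ W with b ∈ B, pt (g b) :=
      Finset.sum_congr rfl fun b hb => by
        rw [if_neg (fun h => Finset.disjoint_left.1 hUW h (Finset.mem_filter.1 hb).1)]
    have e3 : (A ∩ T ∩ ((U ∪ W : Finset α) : Set α)) = (A ∩ T ∩ U) ∪ (A ∩ T ∩ W) := by
      rw [Finset.coe_union, Set.inter_union_distrib_left]
    have hd : Disjoint (A ∩ T ∩ (U : Set α)) (A ∩ T ∩ W) :=
      (Finset.disjoint_coe.2 hUW).mono Set.inter_subset_right Set.inter_subset_right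
    rw [e1, e2, h₁.2, h₂.2, e3, Set.indicator_union_of_disjoint hd]
    funext v
    simp only [Pi.add_apply]
    ring

lemma Feas.union (hUW : Disjoint U W) (h₁ : Feas N A B T U z₁) (h₂ : Feas N A B T W z₂) :
    Feas N A B T (U ∪ W) (z₁ + z₂) :=
  let ⟨_, hf⟩ := h₁
  let ⟨_, hg⟩ := h₂
  ⟨_, hf.union hUW hg⟩

/-- Extending a state by an unmodified state. -/
lemma Feas.extend (h : Feas N A B T W z) (hWU : W ⊆ U) (h0 : Feas N A B T (U \ W) 0) :
    Feas N A B T U z := by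
  have := h.union Finset.disjoint_sdiff h0
  rwa [Finset.union_sdiff_of_subset hWU, add_zero] at this

/-- A modification of a state of `U` inside `W` can be followed to another point of modification,
or to a point at which `W` is adjacent to the rest of `U`. -/
lemma Feas.exit (hAB : Disjoint A B) (h : Feas N A B T U z) (hWU : W ⊆ U)
    (h0 : Feas N A B T W 0) {v₀ : α} (hv₀ : v₀ ∈ W) (hv₀AB : v₀ ∈ A ∨ v₀ ∈ B) (hz : z v₀ = 1) :
    ∃ v ∈ W, Feas N A B T W (pt v₀ + pt v) ∧
      ((z v ≠ 0 ∧ v ≠ v₀) ∨ (v ∈ B ∧ v ≠ v₀ ∧ ∃ a ∈ A, a ∈ U \ W ∧ N v a) ∨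
        (v ∈ A ∧ ∃ b ∈ B, b ∈ U \ W ∧ N b v)) := by
  by_cases hcase : v₀ ∈ A ∧ ∃ b ∈ B, b ∈ U \ W ∧ N b v₀
  · exact ⟨v₀, hv₀, h0.congr (vec_add_self _).symm, Or.inr (Or.inr hcase)⟩
  obtain ⟨f, hf⟩ := h
  -- The state is cut at the border of `W`: a tooth sent out of `W` becomes unassigned. On `A` and
  -- `B` inside `W`, the new modification `z'` can differ from `z` only at such teeth and at spine
  -- vertices with a tooth neighbor in `U \ W`. Exchange at `v₀` with an unmodified state of `W`
  -- then supplies the exit.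
  set g : α → α := fun b => if f b ∈ W then f b else b with hg
  set z' : α → ZMod 2 := ∑ b ∈ W with b ∈ B, pt (g b) + Set.indicator (A ∩ T ∩ W) 1 with hz'
  have hgs : IsState N A B T W g z' := by
    refine ⟨fun b hb hB => ?_, ?_⟩
    · simp only [hg]
      split_ifs with hfb
      · rcases hf.1 b (hWU hb) hB with h | h
        · exact Or.inl h
        · exact Or.inr ⟨hfb, h.2⟩
      · exact Or.inl rfl
    · rw [hz']
      linear_combination -Set.indicator (A ∩ T ∩ (W : Set α)) 1 * (vec_two (α := α))
  have htooth : ∀ b ∈ W, b ∈ B → (z' b ≠ 0 ↔ f b = b ∨ f b ∉ W) := by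
    intro b hb hB
    rw [zmod_ne_zero, hgs.apply_tooth hAB hb hB]
    simp only [hg]
    split_ifs with hfb <;> simp [hfb]
  have hspine : ∀ a ∈ W, a ∈ A → (¬ ∃ b ∈ B, b ∈ U \ W ∧ N b a) → z' a = z a := by
    intro a ha haA hno
    have haB : a ∉ B := fun hB => Set.disjoint_left.1 hAB haA hB
    have h2 := congrFun hf.2 a
    have h3 := congrFun hgs.2 a
    rw [Finset.sum_apply, Pi.add_apply] at h2 h3
    have e : ∑ b ∈ W with b ∈ B, pt (g b) a = ∑ b ∈ U with b ∈ B, pt (f b) a := by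
      rw [← Finset.sum_subset (Finset.filter_subset_filter _ hWU)]
      · refine Finset.sum_congr rfl fun b hb => ?_
        rw [Finset.mem_filter] at hb
        simp only [hg]
        split_ifs with hfb
        · rfl
        · rw [pt_of_ne, pt_of_ne]
          · rintro rfl; exact hfb ha
          · rintro rfl; exact haB hb.2
      · intro b hb hbW
        rw [Finset.mem_filter] at hb hbW
        refine pt_of_ne ?_
        rintro rfl
        rcases hf.1 b hb.1 hb.2 with h | h
        · rw [h] at haB; exact haB hb.2
        · exact hno ⟨b, hb.2, Finset.mem_sdiff.2 ⟨hb.1, fun hbW' => hbW ⟨hbW', hb.2⟩⟩, h.2.2⟩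
    rw [e, h2] at h3
    have hi : Set.indicator (A ∩ T ∩ (U : Set α)) (1 : α → ZMod 2) a =
        Set.indicator (A ∩ T ∩ (W : Set α)) 1 a := by
      simp [Set.indicator, ha, hWU ha]
    rw [hi] at h3
    exact (add_left_cancel h3).symm
  have hout : ∀ v, v ∉ W → z' v = 0 := by
    intro v hv
    have h3 := congrFun hgs.2 v
    rw [Pi.add_apply, Set.indicator_of_notMem (by simp [hv]), zero_add, Finset.sum_apply] at h3
    rw [← h3]
    refine Finset.sum_eq_zero fun b hb => pt_of_ne ?_
    rintro rfl
    rw [Finset.mem_filter] at hb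
    apply hv
    simp only [hg]
    split_ifs with hfb
    · exact hfb
    · exact hb.1
  have hother : ∀ v, v ∈ W → v ∉ A → v ∉ B → z' v = 0 := by
    intro v hv hA hB
    have h3 := congrFun hgs.2 v
    rw [Pi.add_apply, Set.indicator_of_notMem (by simp [hA]), zero_add, Finset.sum_apply] at h3
    rw [← h3]
    refine Finset.sum_eq_zero fun b hb => pt_of_ne ?_
    rintro rfl
    rw [Finset.mem_filter] at hb
    rcases hgs.1 b hb.1 hb.2 with h | h
    · rw [h] at hB; exact hB hb.2
    · exact hA h.2.1
  have hz0 : z' v₀ ≠ 0 := by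
    rcases hv₀AB with hA | hB
    · rw [hspine v₀ hv₀ hA (fun hno => hcase ⟨hA, hno⟩), hz]
      exact one_ne_zero
    · exact (htooth v₀ hv₀ hB).2 (Or.inl ((hf.apply_tooth hAB (hWU hv₀) hB).1 hz))
  obtain ⟨v, hvv, hv, h1, -⟩ := h0.exchange ⟨g, hgs⟩ (u := v₀) (by simpa using hz0.symm)
  have hv' : z' v ≠ 0 := by simpa using hv.symm
  have hvW : v ∈ W := by
    by_contra hvW
    exact hv' (hout v hvW)
  refine ⟨v, hvW, by simpa using h1, ?_⟩
  by_cases hvB : v ∈ B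
  · rcases (htooth v hvW hvB).1 hv' with h | h
    · refine Or.inl ⟨?_, hvv⟩
      rw [(hf.apply_tooth hAB (hWU hvW) hvB).2 h]
      exact one_ne_zero
    · refine Or.inr (Or.inl ⟨hvB, hvv, f v, ?_⟩)
      rcases hf.1 v (hWU hvW) hvB with h' | h'
      · rw [h'] at h; exact absurd hvW h
      · exact ⟨h'.2.1, Finset.mem_sdiff.2 ⟨h'.1, h⟩, h'.2.2⟩
  · have hvA : v ∈ A := by
      by_contra hvA
      exact hv' (hother v hvW hvA hvB)
    by_cases hno : ∃ b ∈ B, b ∈ U \ W ∧ N b v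
    · exact Or.inr (Or.inr ⟨hvA, hno⟩)
    · exact Or.inl ⟨by rwa [← hspine v hvW hvA hno], hvv⟩

end States

/-! ### Allowed pairs and their connectivity classes. -/

section Classes

open scoped Classical

variable {α : Type*}

/-- The tooth `b` is sent to `a` by some unmodified state of `V`. -/
def AllowedPair (N : α → α → Prop) (A B T : Set α) (V : Finset α) (b a : α) : Prop :=
  b ∈ V ∧ b ∈ B ∧ ∃ f, IsState N A B T V f 0 ∧ f b = a

/-- `U` is closed under allowed pairs. -/
def IsClosedUnder (N : α → α → Prop) (A B T : Set α) (V U : Finset α) : Prop :=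
  U ⊆ V ∧ ∀ b a, AllowedPair N A B T V b a → (b ∈ U ↔ a ∈ U)

/-- `C` is a connectivity class of the relation generated by allowed pairs. -/
def IsClass (N : α → α → Prop) (A B T : Set α) (V C : Finset α) : Prop :=
  IsClosedUnder N A B T V C ∧ C.Nonempty ∧ ∀ x ∈ C, ∀ y ∈ C,
    Relation.ReflTransGen (fun x y => AllowedPair N A B T V x y ∨ AllowedPair N A B T V y x) x y

variable {N : α → α → Prop} {A B T : Set α} {V U W C C' : Finset α} {z : α → ZMod 2}

lemma AllowedPair.props (hAB : Disjoint A B) {a b : α} (h : AllowedPair N A B T V b a) :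
    a ∈ V ∧ a ∈ A ∧ N b a := by
  obtain ⟨hb, hB, f, hf, rfl⟩ := h
  rcases hf.1 b hb hB with h | h
  · have := (hf.apply_tooth hAB hb hB).2 h
    simp at this
  · exact h

lemma IsClosedUnder.sdiff (hU : IsClosedUnder N A B T V U) (hW : IsClosedUnder N A B T V W) :
    IsClosedUnder N A B T V (U \ W) :=
  ⟨Finset.sdiff_subset.trans hU.1, fun b a h => by
    rw [Finset.mem_sdiff, Finset.mem_sdiff, hU.2 b a h, hW.2 b a h]⟩

lemma IsClosedUnder.union (hU : IsClosedUnder N A B T V U) (hW : IsClosedUnder N A B T V W) :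
    IsClosedUnder N A B T V (U ∪ W) :=
  ⟨Finset.union_subset hU.1 hW.1, fun b a h => by
    rw [Finset.mem_union, Finset.mem_union, hU.2 b a h, hW.2 b a h]⟩

lemma isClosedUnder_self (hAB : Disjoint A B) : IsClosedUnder N A B T V V :=
  ⟨subset_rfl, fun _ _ h => iff_of_true h.1 (h.props hAB).1⟩

/-- Every pair (b, f b) is allowed, so f maps the teeth inside `U` into `U` and those outside `U`
out of it. -/
lemma IsClosedUnder.restrict (hU : IsClosedUnder N A B T V U) {f : α → α}
    (hf : IsState N A B T V f 0) : IsState N A B T U f 0 := by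
  have hfU : ∀ b ∈ V, b ∈ B → (b ∈ U ↔ f b ∈ U) := fun b hb hB => hU.2 _ _ ⟨hb, hB, f, hf, rfl⟩
  refine ⟨fun b hb hB => ?_, ?_⟩
  · rcases hf.1 b (hU.1 hb) hB with h | h
    · exact Or.inl h
    · exact Or.inr ⟨(hfU b (hU.1 hb) hB).1 hb, h.2⟩
  · funext v
    have h2 := congrFun hf.2 v
    rw [Finset.sum_apply, Pi.add_apply] at h2 ⊢
    by_cases hv : v ∈ U
    · have hi : Set.indicator (A ∩ T ∩ (V : Set α)) (1 : α → ZMod 2) v =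
          Set.indicator (A ∩ T ∩ (U : Set α)) 1 v := by
        simp [Set.indicator, hv, hU.1 hv]
      rw [← hi, ← h2]
      refine Finset.sum_subset (Finset.filter_subset_filter _ hU.1) fun b hb hbU => ?_
      rw [Finset.mem_filter] at hb hbU
      refine pt_of_ne ?_
      rintro rfl
      exact hbU ⟨(hfU b hb.1 hb.2).2 hv, hb.2⟩
    · rw [Set.indicator_of_notMem (by simp [hv]), Pi.zero_apply, add_zero]
      refine Finset.sum_eq_zero fun b hb => pt_of_ne ?_
      rintro rfl
      rw [Finset.mem_filter] at hb
      exact hv ((hfU b (hU.1 hb.1) hb.2).1 hb.1)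

lemma IsClosedUnder.feas (h0 : Feas N A B T V 0)
    (hU : IsClosedUnder N A B T V U) : Feas N A B T U 0 :=
  let ⟨f, hf⟩ := h0
  ⟨f, hU.restrict hf⟩

/-- An unmodified state of `V \ U` extends `f` to all of `V`. -/
lemma IsClosedUnder.allowedPair (hAB : Disjoint A B) (h0 : Feas N A B T V 0)
    (hU : IsClosedUnder N A B T V U) {f : α → α} (hf : IsState N A B T U f 0) {b : α}
    (hb : b ∈ U) (hB : b ∈ B) : AllowedPair N A B T V b (f b) := by
  obtain ⟨g, hg⟩ := ((isClosedUnder_self hAB).sdiff hU).feas h0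
  have := hf.union Finset.disjoint_sdiff hg
  rw [Finset.union_sdiff_of_subset hU.1, add_zero] at this
  exact ⟨hU.1 hb, hB, _, this, by simp [hb]⟩

/-- A tooth of a closed set that could be assigned to `a` in an otherwise unmodified state forms
an allowed pair with `a`. -/
lemma IsClosedUnder.allowedPair_of_feas (hAB : Disjoint A B) (h0 : Feas N A B T V 0)
    (hU : IsClosedUnder N A B T V U) {a b : α} (h : Feas N A B T U (pt b + pt a))
    (hb : b ∈ U) (hB : b ∈ B) (ha : a ∈ U) (haA : a ∈ A) (hN : N b a) :
    AllowedPair N A B T V b a := by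
  obtain ⟨f, hf⟩ := h
  have hba : b ≠ a := by rintro rfl; exact Set.disjoint_left.1 hAB haA hB
  have h1 := hf.assign hAB hb hB (by simp [pt_of_ne hba]) ha haA hN
  have e : pt b + pt a + pt a + pt b = (0 : α → ZMod 2) := by
    linear_combination (pt a + pt b) * (vec_two (α := α))
  rw [e] at h1
  simpa using hU.allowedPair hAB h0 h1 hb hB

lemma AllowedPair.feas (hU : IsClosedUnder N A B T V U) {a b : α}
    (h : AllowedPair N A B T V b a) (hb : b ∈ U) : Feas N A B T U (pt a + pt b) := by
  obtain ⟨-, hB, f, hf, rfl⟩ := h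
  have := (hU.restrict hf).unassign hb hB
  rw [zero_add] at this
  exact ⟨_, this⟩

lemma Feas.extend_closed (h : Feas N A B T W z) (h0 : Feas N A B T V 0)
    (hU : IsClosedUnder N A B T V U) (hW : IsClosedUnder N A B T V W) (hWU : W ⊆ U) : Feas N A B T U z :=
  h.extend hWU ((hU.sdiff hW).feas h0)

lemma IsClosedUnder.mem_of_conn (hU : IsClosedUnder N A B T V U) {x y : α}
    (h : Relation.ReflTransGen
      (fun x y => AllowedPair N A B T V x y ∨ AllowedPair N A B T V y x) x y) (hx : x ∈ U) :
    y ∈ U := by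
  induction h with
  | refl => exact hx
  | tail _ h ih =>
    rcases h with h | h
    · exact (hU.2 _ _ h).1 ih
    · exact (hU.2 _ _ h).2 ih

lemma IsClass.subset_of_mem (hC : IsClass N A B T V C) (hU : IsClosedUnder N A B T V U) {x : α}
    (hxC : x ∈ C) (hxU : x ∈ U) : C ⊆ U :=
  fun y hy => hU.mem_of_conn (hC.2.2 x hxC y hy) hxU

lemma IsClass.eq_of_mem (hC : IsClass N A B T V C) (hC' : IsClass N A B T V C') {x : α}
    (hxC : x ∈ C) (hxC' : x ∈ C') : C = C' :=
  (hC.subset_of_mem hC'.1 hxC hxC').antisymm (hC'.subset_of_mem hC.1 hxC' hxC)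

lemma IsClass.disjoint (hC : IsClass N A B T V C) (hC' : IsClass N A B T V C') (h : C ≠ C') :
    Disjoint C C' :=
  Finset.disjoint_left.2 fun _ hx hx' => h (hC.eq_of_mem hC' hx hx')

/-- A tooth and a spine vertex of the same class can be removed together. -/
lemma IsClass.feas_tooth_spine (hAB : Disjoint A B) (hC : IsClass N A B T V C) {a b : α}
    (hb : b ∈ C) (hB : b ∈ B) (ha : a ∈ C) (haA : a ∈ A) : Feas N A B T C (pt a + pt b) := by
  have hne : ∀ x ∈ A, ∀ y ∈ B, x ≠ y := by
    rintro x hx _ hy rfl; exact Set.disjoint_left.1 hAB hx hy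
  -- Induction along a walk of allowed pairs from `b`. A tooth `v ≠ b` on the walk remembers the
  -- spine vertex `c` before it, which is adjacent to `v` and removable together with `b`.
  have key : ∀ v, Relation.ReflTransGen
      (fun x y => AllowedPair N A B T V x y ∨ AllowedPair N A B T V y x) b v →
      v ∈ C ∧ (v ∈ A → Feas N A B T C (pt v + pt b)) ∧
        (v ∈ B → v = b ∨ ∃ c ∈ C, c ∈ A ∧ N v c ∧ Feas N A B T C (pt c + pt b)) := by
    intro v hv
    induction hv with
    | refl => exact ⟨hb, fun hA => (hne b hA b hB rfl).elim, fun _ => Or.inl rfl⟩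
    | tail _ h ih =>
      rename_i v w _
      obtain ⟨hvC, hv1, hv2⟩ := ih
      rcases h with h | h
      · obtain ⟨-, hwA, hvw⟩ := h.props hAB
        have hvB : v ∈ B := h.2.1
        have hwC := (hC.1.2 _ _ h).1 hvC
        refine ⟨hwC, fun _ => ?_, fun hw => (hne w hwA w hw rfl).elim⟩
        have h2 := h.feas hC.1 hvC
        rcases hv2 hvB with rfl | ⟨c, hcC, hcA, hvc, h1⟩
        · exact h2
        by_cases hvb : v = b
        · rw [← hvb]; exact h2
        by_cases hcw : c = w
        · rw [← hcw]; exact h1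
        have hvc' := hne c hcA v hvB
        have hvw' := hne w hwA v hvB
        have hcb := hne c hcA b hB
        have hwb := hne w hwA b hB
        -- Exchanging {c, b} against {w, v} at `v`, each possible partner leads to {w, b}, after
        -- assigning `v` to `w` or to `c` where needed.
        obtain ⟨x, hxv, hx, h3, h4⟩ := h1.exchange h2 (u := v) (by
          simp [pt_of_ne hvc'.symm, pt_of_ne hvb, pt_of_ne hvw'.symm])
        have hx' : x = c ∨ x = b ∨ x = w := by
          by_contra! hcon
          exact hx (by simp [pt_of_ne, hcon, hxv])
        rcases hx' with rfl | rfl | rfl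
        · refine (h3.assign hAB hvC hvB ?_ hwC hwA hvw).congr ?_
          · simp [pt_of_ne hvc'.symm, pt_of_ne hvb]
          · linear_combination (pt x + pt v) * (vec_two (α := α))
        · refine h4.congr ?_
          linear_combination (pt v) * (vec_two (α := α))
        · refine (h3.assign hAB hvC hvB ?_ hcC hcA hvc).congr ?_
          · simp [pt_of_ne hvc'.symm, pt_of_ne hvb, pt_of_ne hvw'.symm]
          · linear_combination (pt c + pt v) * (vec_two (α := α))
      · obtain ⟨-, hvA, hwv⟩ := h.props hAB
        have hwC := (hC.1.2 _ _ h).2 hvC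
        exact ⟨hwC, fun hwA => (hne w hwA w h.2.1 rfl).elim,
          fun _ => Or.inr ⟨v, hvC, hvA, hwv, hv1 hvA⟩⟩
  exact (key a (hC.2.2 b hb a ha)).2.1 haA

/-- Two spine vertices of the same class can be removed together. -/
lemma IsClass.feas_spine_spine (hAB : Disjoint A B) (h0 : Feas N A B T V 0)
    (hC : IsClass N A B T V C) {a a' : α}
    (ha : a ∈ C) (haA : a ∈ A) (ha' : a' ∈ C) (haA' : a' ∈ A) :
    Feas N A B T C (pt a + pt a') := by
  -- The walk from `a'` starts with an allowed pair; its tooth `b` is removable together with `a`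
  -- and can then be assigned to `a'`.
  rcases (hC.2.2 a' ha' a ha).cases_head with rfl | ⟨b, h, -⟩
  · exact (hC.1.feas h0).congr (vec_add_self _).symm
  rcases h with h | h
  · exact (Set.disjoint_left.1 hAB haA' h.2.1).elim
  have hbC := (hC.1.2 _ _ h).2 ha'
  have hba : b ≠ a := by rintro rfl; exact Set.disjoint_left.1 hAB haA h.2.1
  refine ((hC.feas_tooth_spine hAB hbC h.2.1 ha haA).assign hAB hbC h.2.1 ?_ ha' haA'
    (h.props hAB).2.2).congr ?_
  · simp [pt_of_ne hba]
  · linear_combination (pt b) * (vec_two (α := α))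

end Classes

/-! ### Critical sets and transitivity. -/

section Critical

open scoped Classical

variable {α : Type*}

/-- The combinatorial form of a critical set `X` for the class `C`. -/
def IsCriticalFor (N : α → α → Prop) (A B T : Set α) (V C X : Finset α) : Prop :=
  IsClosedUnder N A B T V X ∧ C ⊆ X ∧ (∀ a ∈ C, a ∈ A → ∀ b ∈ X \ C, b ∈ B → ¬ N b a) ∧
    ∀ v ∈ X \ C, ∃ p ∈ X \ C, p ∈ A ∧ ∃ c ∈ C, c ∈ B ∧ N c p ∧ Feas N A B T (X \ C) (pt v + pt p)

variable {N : α → α → Prop} {A B T : Set α} {V U W C C₁ C₂ X Y : Finset α} {z : α → ZMod 2}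

/-- Joining two states by an edge from an unassigned tooth. -/
lemma Feas.link (hAB : Disjoint A B) (hUW : Disjoint U W) {a b v : α}
    (h₁ : Feas N A B T U (pt v + pt b)) (h₂ : Feas N A B T W (pt a + z)) (hvb : v ≠ b)
    (hzb : z b = 0) (hb : b ∈ U) (hB : b ∈ B) (ha : a ∈ W) (haA : a ∈ A) (hN : N b a) :
    Feas N A B T (U ∪ W) (pt v + z) := by
  have hba : b ≠ a := by rintro rfl; exact Set.disjoint_left.1 hAB haA hB
  refine ((h₁.union hUW h₂).assign hAB (Finset.mem_union_left _ hb) hB ?_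
    (Finset.mem_union_right _ ha) haA hN).congr ?_
  · simp [pt_of_ne hvb.symm, pt_of_ne hba, hzb]
  · linear_combination (pt a + pt b) * (vec_two (α := α))

/-- The state of `Y \ C` leading from `v₀` to a neighbor of a tooth of `C` is cut at the border of
`Y \ X`. Whether it crosses into `X \ C` or ends at that neighbor, the edge leaving `Y \ X` ends in
`X`, because `C ⊆ X`. -/
lemma IsCriticalFor.exit (hAB : Disjoint A B) (hVAB : ∀ v ∈ V, v ∈ A ∨ v ∈ B)
    (h0 : Feas N A B T V 0)
    (hX : IsClosedUnder N A B T V X) (hCX : C ⊆ X)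
    (hY : IsCriticalFor N A B T V C Y) {v₀ : α} (hv₀ : v₀ ∈ Y \ X) :
    ∃ v ∈ Y \ X, Feas N A B T (Y \ X) (pt v₀ + pt v) ∧
      ((v ∈ A ∧ ∃ d ∈ X, d ∈ B ∧ N d v) ∨ (v ∈ B ∧ v ≠ v₀ ∧ ∃ a ∈ X, a ∈ A ∧ N v a)) := by
  have hWU : Y \ X ⊆ Y \ C := Finset.sdiff_subset_sdiff subset_rfl hCX
  obtain ⟨p, hp, hpA, c, hc, hcB, hcp, h⟩ := hY.2.2.2 v₀ (hWU hv₀)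
  have hW0 : Feas N A B T (Y \ X) 0 := (hY.1.sdiff hX).feas h0
  have hmem : ∀ x ∈ (Y \ C) \ (Y \ X), x ∈ X := by
    intro x hx
    simp only [Finset.mem_sdiff] at hx
    by_contra hxX
    exact hx.2 ⟨hx.1.1, hxX⟩
  by_cases hpv : v₀ = p
  · subst hpv
    exact ⟨v₀, hv₀, hW0.congr (vec_add_self _).symm, Or.inl ⟨hpA, c, hCX hc, hcB, hcp⟩⟩
  obtain ⟨v, hv, hvf, hcase⟩ := h.exit hAB hWU hW0 hv₀
    (hVAB _ (hY.1.1 (Finset.mem_sdiff.1 hv₀).1)) (by simp [pt_of_ne hpv])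
  refine ⟨v, hv, hvf, ?_⟩
  rcases hcase with ⟨hz, hvv⟩ | ⟨hvB, hvv, a, haA, ha, hN⟩ | ⟨hvA, b, hbB, hb, hN⟩
  · rw [Pi.add_apply, pt_of_ne hvv, zero_add, pt_ne_zero] at hz
    subst hz
    exact Or.inl ⟨hpA, c, hCX hc, hcB, hcp⟩
  · exact Or.inr ⟨hvB, hvv, a, hmem a ha, haA, hN⟩
  · exact Or.inl ⟨hvA, b, hmem b hb, hbB, hN⟩

/-- If `X` is critical for `C₁` and contains `C₂`, and `Y` is critical for `C₂`, then `X ∪ Y` is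
critical for `C₁`. -/
lemma IsCriticalFor.union (hAB : Disjoint A B) (hVAB : ∀ v ∈ V, v ∈ A ∨ v ∈ B)
    (h0 : Feas N A B T V 0) (hC₁ : IsClass N A B T V C₁)
    (hX : IsCriticalFor N A B T V C₁ X) (hC₂X : C₂ ⊆ X) (hY : IsCriticalFor N A B T V C₂ Y) :
    IsCriticalFor N A B T V C₁ (X ∪ Y) := by
  have hne : ∀ x ∈ A, ∀ y ∈ B, x ≠ y := by
    rintro x hx _ hy rfl; exact Set.disjoint_left.1 hAB hx hy
  have hXY := hX.1.union hY.1
  have hC₁XY : C₁ ⊆ X ∪ Y := hX.2.1.trans Finset.subset_union_left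
  have hO := hXY.sdiff hC₁.1
  have hOX := hX.1.sdiff hC₁.1
  have hW := hY.1.sdiff hX.1
  have hOXO : X \ C₁ ⊆ (X ∪ Y) \ C₁ :=
    Finset.sdiff_subset_sdiff Finset.subset_union_left subset_rfl
  have hWO : Y \ X ⊆ (X ∪ Y) \ C₁ :=
    Finset.sdiff_subset_sdiff Finset.subset_union_right hX.2.1
  have hdXW : Disjoint (X \ C₁) (Y \ X) :=
    Finset.disjoint_of_subset_left Finset.sdiff_subset Finset.disjoint_sdiff
  have hunion : X \ C₁ ∪ Y \ X = (X ∪ Y) \ C₁ := by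
    ext x
    have := @hX.2.1 x
    simp only [Finset.mem_union, Finset.mem_sdiff]
    tauto
  have hdW₁ : Disjoint (Y \ X) C₁ :=
    Finset.disjoint_of_subset_right hX.2.1 Finset.sdiff_disjoint
  -- The second alternative, entering `C₁` at a spine vertex, is impossible once `color` is known;
  -- `color` itself has to handle both.
  have good : ∀ v₀ ∈ Y \ X,
      (∃ p ∈ (X ∪ Y) \ C₁, p ∈ A ∧ ∃ c ∈ C₁, c ∈ B ∧ N c p ∧
        Feas N A B T ((X ∪ Y) \ C₁) (pt v₀ + pt p)) ∨
      ∃ v ∈ Y \ X, v ∈ B ∧ v ≠ v₀ ∧ Feas N A B T (Y \ X) (pt v₀ + pt v) ∧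
        ∃ a ∈ C₁, a ∈ A ∧ N v a := by
    intro v₀ hv₀
    obtain ⟨v, hv, hvf, ⟨hvA, d, hd, hdB, hN⟩ | ⟨hvB, hvv, a, ha, haA, hN⟩⟩ :=
      IsCriticalFor.exit hAB hVAB h0 hX.1 hC₂X hY hv₀
    · left
      by_cases hd₁ : d ∈ C₁
      · exact ⟨v, hWO hv, hvA, d, hd₁, hdB, hN, hvf.extend_closed h0 hO hW hWO⟩
      · have hdX : d ∈ X \ C₁ := Finset.mem_sdiff.2 ⟨hd, hd₁⟩
        obtain ⟨p, hp, hpA, c, hc, hcB, hcp, hpf⟩ := hX.2.2.2 d hdX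
        refine ⟨p, hOXO hp, hpA, c, hc, hcB, hcp, ?_⟩
        rw [add_comm] at hpf hvf
        have hdv₀ : d ≠ v₀ := by
          rintro rfl; exact (Finset.mem_sdiff.1 hv₀).2 hd
        have := hpf.link hAB hdXW hvf (hne p hpA d hdB) (pt_of_ne hdv₀) hdX hdB hv hvA hN
        rwa [hunion, add_comm] at this
    · by_cases ha₁ : a ∈ C₁
      · exact Or.inr ⟨v, hv, hvB, hvv, hvf, a, ha₁, haA, hN⟩
      · left
        have haX : a ∈ X \ C₁ := Finset.mem_sdiff.2 ⟨ha, ha₁⟩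
        obtain ⟨p, hp, hpA, c, hc, hcB, hcp, hpf⟩ := hX.2.2.2 a haX
        refine ⟨p, hOXO hp, hpA, c, hc, hcB, hcp, ?_⟩
        have := hvf.link hAB hdXW.symm hpf hvv.symm (pt_of_ne (hne p hpA v hvB).symm) hv hvB haX
          haA hN
        rwa [Finset.union_comm, hunion] at this
  -- In either alternative for `t`, gluing with a state of `C₁` makes `t` and `a` removable together
  -- in a closed set. An edge between them would then be an allowed pair and put `t` in `C₁`.
  have color : ∀ a ∈ C₁, a ∈ A → ∀ t ∈ Y \ X, t ∈ B → ¬ N t a := by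
    intro a ha haA t ht htB hta
    have htC : t ∉ C₁ := Finset.disjoint_left.1 hdW₁ ht
    rcases good t ht with ⟨p, hp, hpA, c, hc, hcB, hcp, hpf⟩ |
      ⟨v, hv, hvB, hvt, hvf, a', ha', haA', hN⟩
    · have htc : c ≠ t := by rintro rfl; exact htC hc
      rw [add_comm] at hpf
      have h1 := (hC₁.feas_tooth_spine hAB hc hcB ha haA).link hAB
        (Finset.disjoint_sdiff (s := C₁) (t := X ∪ Y)) hpf (hne a haA c hcB) (pt_of_ne htc) hc hcB
        hp hpA hcp
      rw [Finset.union_sdiff_of_subset hC₁XY, add_comm] at h1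
      have h2 := hXY.allowedPair_of_feas hAB h0 h1
        (Finset.mem_union_right _ (Finset.mem_sdiff.1 ht).1) htB (hC₁XY ha) haA hta
      exact htC ((hC₁.1.2 _ _ h2).2 ha)
    · have h1 := hvf.link hAB hdW₁ (hC₁.feas_spine_spine hAB h0 ha' haA' ha haA) hvt.symm
        (pt_of_ne (hne a haA v hvB).symm) hv hvB ha' haA' hN
      have h2 := (hW.union hC₁.1).allowedPair_of_feas hAB h0 h1
        (Finset.mem_union_left _ ht) htB (Finset.mem_union_right _ ha) haA hta
      exact htC ((hC₁.1.2 _ _ h2).2 ha)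
  refine ⟨hXY, hC₁XY, fun a ha haA b hb hB => ?_, fun v hv => ?_⟩
  · rw [← hunion, Finset.mem_union] at hb
    rcases hb with hb | hb
    · exact hX.2.2.1 a ha haA b hb hB
    · exact color a ha haA b hb hB
  · have hv' := hv
    rw [← hunion, Finset.mem_union] at hv
    rcases hv with hv | hv
    · obtain ⟨p, hp, hpA, c, hc, hcB, hcp, hpf⟩ := hX.2.2.2 v hv
      exact ⟨p, hOXO hp, hpA, c, hc, hcB, hcp, hpf.extend_closed h0 hO hOX hOXO⟩
    · rcases good v hv with h | ⟨w, hw, hwB, -, -, a, ha, haA, hN⟩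
      · exact h
      · exact (color a ha haA w hw hwB hN).elim

end Critical

/-! ### Antisymmetry: a set is critical for at most one class. -/

section Antisymmetry

open scoped Classical

variable {α : Type*}

variable {N : α → α → Prop} {A B T : Set α} {V W D C C₁ C₂ K : Finset α}

/-- Not being removable together, outside the class `C`, is transitive on the teeth of `C`. -/
lemma IsClass.feas_tooth_trans (hAB : Disjoint A B) (h0 : Feas N A B T V 0)
    (hC : IsClass N A B T V C) (hW : IsClosedUnder N A B T V W) (hCW : C ⊆ W) {c c' c'' : α}
    (hc : c ∈ C) (hB : c ∈ B) (hc' : c' ∈ C) (hB' : c' ∈ B)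
    (h : c = c' ∨ ¬ Feas N A B T W (pt c + pt c'))
    (h' : c' = c'' ∨ ¬ Feas N A B T W (pt c' + pt c'')) :
    c = c'' ∨ ¬ Feas N A B T W (pt c + pt c'') := by
  rcases h with rfl | h
  · exact h'
  rcases h' with rfl | h'
  · exact Or.inr h
  by_contra! hcon
  obtain ⟨hcc, hf⟩ := hcon
  have hcc' : c ≠ c' := by
    rintro rfl; exact h' hf
  have hcc'' : c' ≠ c'' := by
    rintro rfl; exact h hf
  -- Let `a` be the value at `c` of an unmodified state; it lies in `C`, so {a, c'} is removable.
  -- Exchanging {c, c''} against it at `c'` yields {c', c''} or {c, c'}, both excluded; with partner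
  -- `a`, the tooth `c` is first assigned to `a`.
  obtain ⟨f, hf0⟩ := id h0
  have hca : AllowedPair N A B T V c (f c) := ⟨hW.1 (hCW hc), hB, f, hf0, rfl⟩
  obtain ⟨-, haA, hN⟩ := hca.props hAB
  have haC := (hC.1.2 _ _ hca).1 hc
  have hac : c ≠ f c := by
    intro e; rw [← e] at haA; exact Set.disjoint_left.1 hAB haA hB
  have hac' : c' ≠ f c := by
    intro e; rw [← e] at haA; exact Set.disjoint_left.1 hAB haA hB'
  generalize f c = a at *
  have h1 : Feas N A B T W (pt a + pt c') :=
    (hC.feas_tooth_spine hAB hc' hB' haC haA).extend_closed h0 hW hC.1 hCW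
  obtain ⟨v, hvc, hv, h2, h3⟩ := hf.exchange h1 (u := c') (by
    simp [pt_of_ne hcc'.symm, pt_of_ne hcc'', pt_of_ne hac'])
  have hv' : v = c ∨ v = c'' ∨ v = a := by
    by_contra! hcon
    exact hv (by simp [pt_of_ne, hcon, hvc])
  rcases hv' with rfl | rfl | rfl
  · refine h' (h2.congr ?_)
    linear_combination pt v * (vec_two (α := α))
  · refine h (h2.congr ?_)
    linear_combination pt v * (vec_two (α := α))
  · refine h' ((h2.assign hAB (hCW hc) hB ?_ (hCW haC) haA hN).congr ?_)
    · simp [pt_of_ne hcc, pt_of_ne hcc', pt_of_ne hac]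
    · linear_combination (pt c + pt v) * (vec_two (α := α))

/-- If `D` is a connected part of `K \ C` not joined to the rest of `K \ C`, every tooth of which
can be removed together with a neighbor of a tooth of `C`, then all teeth of `C` adjacent to `D`
are pairwise not removable together outside `D`. -/
lemma IsClass.contacts_equiv (hAB : Disjoint A B) (h0 : Feas N A B T V 0)
    (hC : IsClass N A B T V C) (hW : IsClosedUnder N A B T V W) (hCW : C ⊆ W)
    (hD : IsClosedUnder N A B T V D) (hWD : Disjoint W D)
    (hcrit : ∀ b ∈ D, b ∈ B → ∃ p ∈ D, p ∈ A ∧ ∃ c ∈ C, c ∈ B ∧ N c p ∧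
      Feas N A B T D (pt b + pt p))
    {c c' p p' : α} (hc : c ∈ C) (hcB : c ∈ B) (hc' : c' ∈ C) (hcB' : c' ∈ B)
    (hp : p ∈ D) (hpA : p ∈ A) (hpA' : p' ∈ A) (hcp : N c p)
    (hcp' : N c' p')
    (hconn : Relation.ReflTransGen (fun x y => x ∈ D ∧ y ∈ D ∧
      ((x ∈ B ∧ y ∈ A ∧ N x y) ∨ (y ∈ B ∧ x ∈ A ∧ N y x))) p p') :
    c = c' ∨ ¬ Feas N A B T W (pt c + pt c') := by
  have hne : ∀ x ∈ A, ∀ y ∈ B, x ≠ y := by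
    rintro x hx _ hy rfl; exact Set.disjoint_left.1 hAB hx hy
  set E : α → α → Prop := fun c c' => c = c' ∨ ¬ Feas N A B T W (pt c + pt c') with hE
  have hsymm : ∀ {x y}, E x y → E y x := by
    rintro x y (h | h)
    · exact Or.inl h.symm
    · exact Or.inr (by rwa [add_comm])
  have htrans : ∀ {x y w}, x ∈ C → x ∈ B → y ∈ C → y ∈ B → E x y → E y w → E x w :=
    fun hx hxB hy hyB h h' => hC.feas_tooth_trans hAB h0 hW hCW hx hxB hy hyB h h'
  -- Otherwise gluing along `c₂ p₂` makes `c₁` and `p₁` removable together, so this edge is allowed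
  -- and places `p₁` in `C`, which is disjoint from `D`.
  have hcontact : ∀ {c₁ c₂ p₁ p₂}, c₁ ∈ C → c₁ ∈ B → c₂ ∈ C → c₂ ∈ B → p₁ ∈ D → p₁ ∈ A →
      p₂ ∈ D → p₂ ∈ A → N c₁ p₁ → N c₂ p₂ → Feas N A B T D (pt p₁ + pt p₂) → E c₁ c₂ := by
    intro c₁ c₂ p₁ p₂ h1 h1B h2 h2B hp1 hp1A hp2 hp2A hN1 hN2 hf
    by_contra hcon
    simp only [hE, not_or, not_not] at hcon
    rw [add_comm] at hf
    have h3 := hcon.2.link hAB hWD hf hcon.1 (pt_of_ne (hne p₁ hp1A c₂ h2B).symm) (hCW h2) h2B hp2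
      hp2A hN2
    have h4 := (hW.union hD).allowedPair_of_feas hAB h0 h3 (Finset.mem_union_left _ (hCW h1)) h1B
      (Finset.mem_union_right _ hp1) hp1A hN1
    exact Finset.disjoint_left.1 hWD (hCW ((hC.1.2 _ _ h4).1 h1)) hp1
  have hD0 := hD.feas h0
  -- `M b`: every contact tooth of `C` that the tooth `b` reaches through `D` is equivalent to `c`.
  -- This property is propagated along a walk in `D`.
  set M : α → Prop := fun b => ∀ c₁ ∈ C, c₁ ∈ B → ∀ p₁ ∈ D, p₁ ∈ A → N c₁ p₁ →
    Feas N A B T D (pt b + pt p₁) → E c c₁ with hM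
  have hadj : ∀ b ∈ D, b ∈ B → ∀ q ∈ D, q ∈ A → N b q → ∀ p₁, p₁ ∈ A →
      Feas N A B T D (pt b + pt p₁) → Feas N A B T D (pt q + pt p₁) := by
    intro b hb hB q hq hqA hN p₁ hp1A hf
    refine (hf.assign hAB hb hB ?_ hq hqA hN).congr ?_
    · simp [pt_of_ne (hne p₁ hp1A b hB).symm]
    · linear_combination pt b * (vec_two (α := α))
  have hstep : ∀ q ∈ D, q ∈ A → ∀ b ∈ D, b ∈ B → N b q → ∀ b' ∈ D, b' ∈ B → N b' q → M b → M b' := by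
    intro q hq hqA b hb hB hN b' hb' hB' hN' hMb c₁ hc1 hc1B p₁ hp1 hp1A hN1 hf1
    obtain ⟨p₂, hp2, hp2A, c₂, hc2, hc2B, hN2, hf2⟩ := hcrit b hb hB
    have hEc2 := hMb c₂ hc2 hc2B p₂ hp2 hp2A hN2 hf2
    by_contra hcon
    have hcon2 : ¬ E c₂ c₁ := fun h => hcon (htrans hc hcB hc2 hc2B hEc2 h)
    have hpp : ¬ Feas N A B T D (pt p₂ + pt p₁) := fun h =>
      hcon2 (hcontact hc2 hc2B hc1 hc1B hp2 hp2A hp1 hp1A hN2 hN1 h)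
    have hpne : p₂ ≠ p₁ := by
      rintro rfl; exact hpp (hD0.congr (vec_add_self _).symm)
    have hbb : b ≠ b' := by
      rintro rfl; exact hcon (hMb c₁ hc1 hc1B p₁ hp1 hp1A hN1 hf1)
    have n1 := hne p₂ hp2A b hB
    have n2 := hne p₂ hp2A b' hB'
    have n3 := hne p₁ hp1A b hB
    have n4 := hne p₁ hp1A b' hB'
    have n5 := hne q hqA b hB
    have n6 := hne q hqA b' hB'
    -- Exchange {b, p₂} against {b', p₁} at `p₂`. Partner `b` or `b'` makes {p₁, p₂} removable (for
    -- `b`, after assigning both teeth to `q`), which is excluded. Partner `p₁` gives {b, p₁}, so `M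
    -- b` applies to `c₁`.
    obtain ⟨v, hvp, hv, h3, h4⟩ := hf2.exchange hf1 (u := p₂) (by
      simp [pt_of_ne n1, pt_of_ne n2, pt_of_ne hpne])
    have hv' : v = b ∨ v = b' ∨ v = p₁ := by
      by_contra! h
      exact hv (by simp [pt_of_ne, h, hvp])
    rcases hv' with rfl | rfl | rfl
    · have h5 := h4.assign hAB hb hB (by
        simp [pt_of_ne hbb, pt_of_ne n3.symm, pt_of_ne n1.symm]) hq hqA hN
      have h6 := h5.assign hAB hb' hB' (by
        simp [pt_of_ne hbb.symm, pt_of_ne n4.symm, pt_of_ne n2.symm, pt_of_ne n6.symm]) hq hqA hN'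
      refine hpp (h6.congr ?_)
      linear_combination (pt b' + pt v + pt q) * (vec_two (α := α))
    · refine hpp (h4.congr ?_)
      linear_combination pt v * (vec_two (α := α))
    · refine hcon (hMb c₁ hc1 hc1B v hp1 hp1A hN1 (h3.congr ?_))
      linear_combination pt p₂ * (vec_two (α := α))
  have key : ∀ v, Relation.ReflTransGen (fun x y => x ∈ D ∧ y ∈ D ∧
      ((x ∈ B ∧ y ∈ A ∧ N x y) ∨ (y ∈ B ∧ x ∈ A ∧ N y x))) p v →
      (v ∈ B → M v) ∧ (v ∈ A → (∀ b ∈ D, b ∈ B → N b v → M b) ∧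
        ∀ c₁ ∈ C, c₁ ∈ B → N c₁ v → E c c₁) := by
    intro v hv
    induction hv with
    | refl =>
      refine ⟨fun hB => (hne p hpA p hB rfl).elim, fun _ => ⟨fun b hb hB hN => ?_, ?_⟩⟩
      · intro c₁ hc1 hc1B p₁ hp1 hp1A hN1 hf1
        exact hcontact hc hcB hc1 hc1B hp hpA hp1 hp1A hcp hN1
          (hadj b hb hB p hp hpA hN p₁ hp1A hf1)
      · intro c₁ hc1 hc1B hN1
        exact hcontact hc hcB hc1 hc1B hp hpA hp hpA hcp hN1 (hD0.congr (vec_add_self _).symm)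
    | tail _ h ih =>
      rename_i v w _
      obtain ⟨hv, hw, ⟨hvB, hwA, hN⟩ | ⟨hwB, hvA, hN⟩⟩ := h
      · refine ⟨fun hB => (hne w hwA w hB rfl).elim, fun _ => ⟨fun b hb hB hN' => ?_, ?_⟩⟩
        · exact hstep w hw hwA v hv hvB hN b hb hB hN' (ih.1 hvB)
        · intro c₁ hc1 hc1B hN1
          obtain ⟨p₂, hp2, hp2A, c₂, hc2, hc2B, hN2, hf2⟩ := hcrit v hv hvB
          have h1 := ih.1 hvB c₂ hc2 hc2B p₂ hp2 hp2A hN2 hf2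
          have h2 := hcontact hc1 hc1B hc2 hc2B hw hwA hp2 hp2A hN1 hN2
            (hadj v hv hvB w hw hwA hN p₂ hp2A hf2)
          exact htrans hc hcB hc2 hc2B h1 (hsymm h2)
      · exact ⟨fun _ => (ih.2 hvA).1 w hw hwB hN, fun hA => (hne w hA w hwB rfl).elim⟩
  exact ((key p' hconn).2 hpA').2 c' hc' hcB' hcp'

/-- No set is critical for two different classes contained in it. -/
lemma IsCriticalFor.class_unique (hAB : Disjoint A B) (hVAB : ∀ v ∈ V, v ∈ A ∨ v ∈ B)
    (h0 : Feas N A B T V 0) (hC₁ : IsClass N A B T V C₁) (hC₂ : IsClass N A B T V C₂)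
    (h₁ : IsCriticalFor N A B T V C₁ K) (h₂ : IsCriticalFor N A B T V C₂ K) : C₁ = C₂ := by
  by_contra hne₁₂
  have hdisj := hC₁.disjoint hC₂ hne₁₂
  have hne : ∀ x ∈ A, ∀ y ∈ B, x ≠ y := by
    rintro x hx _ hy rfl; exact Set.disjoint_left.1 hAB hx hy
  obtain ⟨v₀, hv₀⟩ := hC₂.2.1
  have hC₂K : C₂ ⊆ K \ C₁ := fun x hx =>
    Finset.mem_sdiff.2 ⟨h₂.2.1 hx, Finset.disjoint_right.1 hdisj hx⟩
  set O := K \ C₁ with hO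
  have hOc : IsClosedUnder N A B T V O := h₁.1.sdiff hC₁.1
  set R : α → α → Prop := fun x y => x ∈ O ∧ y ∈ O ∧
    ((x ∈ B ∧ y ∈ A ∧ N x y) ∨ (y ∈ B ∧ x ∈ A ∧ N y x)) with hR
  have hRsymm : ∀ x y, R x y → R y x := fun x y h => ⟨h.2.1, h.1, h.2.2.symm⟩
  -- `D` is the component of `C₂` in the graph induced on `O`. No edge leaves it inside `O`, so its
  -- only contacts with the rest of `K` are with `C₁`.
  set D := O.filter (fun v => Relation.ReflTransGen R v₀ v) with hDdef
  have hDO : D ⊆ O := Finset.filter_subset _ _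
  have hDR : ∀ x y, R x y → (x ∈ D ↔ y ∈ D) := by
    intro x y h
    simp only [hDdef, Finset.mem_filter]
    exact ⟨fun hx => ⟨h.2.1, hx.2.tail h⟩, fun hy => ⟨h.1, hy.2.tail (hRsymm _ _ h)⟩⟩
  have hDN : ∀ b ∈ O, b ∈ B → ∀ a ∈ O, a ∈ A → N b a → (b ∈ D ↔ a ∈ D) :=
    fun b hb hB a ha hA hN => hDR b a ⟨hb, ha, Or.inl ⟨hB, hA, hN⟩⟩
  have hDc : IsClosedUnder N A B T V D := by
    refine ⟨hDO.trans hOc.1, fun b a h => ?_⟩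
    by_cases hb : b ∈ O
    · exact hDN b hb h.2.1 a ((hOc.2 b a h).1 hb) (h.props hAB).2.1 (h.props hAB).2.2
    · exact iff_of_false (fun hbD => hb (hDO hbD)) (fun haD => hb ((hOc.2 b a h).2 (hDO haD)))
  have hv₀D : v₀ ∈ D := Finset.mem_filter.2 ⟨hC₂K hv₀, Relation.ReflTransGen.refl⟩
  have hC₂D : C₂ ⊆ D := hC₂.subset_of_mem hDc hv₀ hv₀D
  have hDK : D ⊆ K := hDO.trans Finset.sdiff_subset
  set W := K \ D with hWdef
  have hWc : IsClosedUnder N A B T V W := h₁.1.sdiff hDc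
  have hC₁W : C₁ ⊆ W := fun x hx =>
    Finset.mem_sdiff.2 ⟨h₁.2.1 hx, fun hxD => (Finset.mem_sdiff.1 (hDO hxD)).2 hx⟩
  have hKWD : ∀ x ∈ K \ W, x ∈ D := by
    intro x hx
    simp only [hWdef, Finset.mem_sdiff] at hx
    by_contra hxD
    exact hx.2 ⟨hx.1, hxD⟩
  have hWO : ∀ x ∈ W, x ∉ C₁ → x ∈ O := fun x hx hx1 =>
    Finset.mem_sdiff.2 ⟨(Finset.mem_sdiff.1 hx).1, hx1⟩
  -- A state of `O` cut at the border of `D` has no edge to leave by, so the reach condition for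
  -- `C₁` already holds within `D`.
  have hcrit : ∀ b ∈ D, ∃ p ∈ D, p ∈ A ∧ ∃ c ∈ C₁, c ∈ B ∧ N c p ∧
      Feas N A B T D (pt b + pt p) := by
    intro b hb
    obtain ⟨p, hp, hpA, c, hc, hcB, hcp, hf⟩ := h₁.2.2.2 b (hDO hb)
    by_cases hbp : b = p
    · subst hbp
      exact ⟨b, hb, hpA, c, hc, hcB, hcp, (hDc.feas h0).congr (vec_add_self _).symm⟩
    obtain ⟨v, hv, hvf, hcase⟩ := hf.exit hAB hDO (hDc.feas h0) hb (hVAB b (hDc.1 hb))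
      (by simp [pt_of_ne hbp])
    rcases hcase with ⟨hz, hvv⟩ | ⟨hvB, -, a, haA, ha, hN⟩ | ⟨hvA, b', hB', hb', hN⟩
    · rw [Pi.add_apply, pt_of_ne hvv, zero_add, pt_ne_zero] at hz
      subst hz
      exact ⟨v, hv, hpA, c, hc, hcB, hcp, hvf⟩
    · rw [Finset.mem_sdiff] at ha
      exact (ha.2 ((hDN v (hDO hv) hvB a ha.1 haA hN).1 hv)).elim
    · rw [Finset.mem_sdiff] at hb'
      exact (hb'.2 ((hDN b' hb'.1 hB' v (hDO hv) hvA hN).2 hv)).elim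
  have hRD : ∀ x y, Relation.ReflTransGen R x y → x ∈ D → Relation.ReflTransGen
      (fun x y => x ∈ D ∧ y ∈ D ∧ ((x ∈ B ∧ y ∈ A ∧ N x y) ∨ (y ∈ B ∧ x ∈ A ∧ N y x))) x y ∧
      y ∈ D := by
    intro x y h hx
    induction h with
    | refl => exact ⟨Relation.ReflTransGen.refl, hx⟩
    | tail _ h ih =>
      have := (hDR _ _ h).1 ih.2
      exact ⟨ih.1.tail ⟨ih.2, this, h.2.2⟩, this⟩
  have hRrev : ∀ x y, Relation.ReflTransGen R x y → Relation.ReflTransGen R y x := by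
    intro x y h
    induction h with
    | refl => exact Relation.ReflTransGen.refl
    | tail _ h ih => exact ih.head (hRsymm _ _ h)
  obtain ⟨p₀, hp₀, hp₀A, c₀, hc₀, hc₀B, hN₀, -⟩ := hcrit v₀ hv₀D
  have hc₀₂ : c₀ ∉ C₂ := Finset.disjoint_left.1 hdisj hc₀
  -- Criticality for `C₂` at the contact tooth `c₀`: the endpoint `p` is adjacent to a tooth of
  -- `C₂`, hence lies in `D`. Cutting at `W = K \ D` therefore forces a second contact from `W` to
  -- `D`.
  obtain ⟨p, hp, hpA, c, hc, hcB, hcp, hf⟩ :=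
    h₂.2.2.2 c₀ (Finset.mem_sdiff.2 ⟨h₁.2.1 hc₀, hc₀₂⟩)
  have hpK := (Finset.mem_sdiff.1 hp).1
  have hp1 : p ∉ C₁ := fun hp1 => h₁.2.2.1 p hp1 hpA c (hC₂K hc) hcB hcp
  have hpD : p ∈ D := (hDN c (hC₂K hc) hcB p (Finset.mem_sdiff.2 ⟨hpK, hp1⟩) hpA hcp).1 (hC₂D hc)
  have hf' := hf.extend_closed h0 h₁.1 (h₁.1.sdiff hC₂.1) Finset.sdiff_subset
  obtain ⟨v, hv, hvf, hcase⟩ := hf'.exit hAB (Finset.sdiff_subset (s := K) (t := D))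
    (hWc.feas h0) (hC₁W hc₀) (Or.inr hc₀B) (by simp [pt_of_ne (hne p hpA c₀ hc₀B).symm])
  rcases hcase with ⟨hz, hvv⟩ | ⟨hvB, hvv, a, haA, ha, hN⟩ | ⟨hvA, b', hB', hb', hN⟩
  · rw [Pi.add_apply, pt_of_ne hvv, zero_add, pt_ne_zero] at hz
    subst hz
    exact (Finset.mem_sdiff.1 hv).2 hpD
  · have haD := hKWD a ha
    have hvC : v ∈ C₁ := by
      by_contra hvC
      exact (Finset.mem_sdiff.1 hv).2 ((hDN v (hWO v hv hvC) hvB a (hDO haD) haA hN).2 haD)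
    have hconn : Relation.ReflTransGen R p₀ a :=
      (hRrev _ _ (Finset.mem_filter.1 hp₀).2).trans (Finset.mem_filter.1 haD).2
    rcases hC₁.contacts_equiv hAB h0 hWc hC₁W hDc Finset.sdiff_disjoint (fun b hb _ => hcrit b hb)
      hc₀ hc₀B hvC hvB hp₀ hp₀A haA hN₀ hN (hRD _ _ hconn hp₀).1 with h | h
    · exact hvv h.symm
    · exact h hvf
  · have hbD := hKWD b' hb'
    by_cases hvC : v ∈ C₁
    · exact h₁.2.2.1 v hvC hvA b' (hDO hbD) hB' hN
    · exact (Finset.mem_sdiff.1 hv).2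
        ((hDN b' (hDO hbD) hB' v (hWO v hv hvC) hvA hN).1 hbD)

end Antisymmetry

/-! ### Joins attaining the lower bound by terminal teeth. -/

section Selections

open scoped Classical

variable {α β : Type*}

/-- `f` sends every terminal tooth to a neighbor such that the terminal spine vertices are those
chosen an odd number of times. -/
def IsSelection (Q : Graph α β) (T A B : Set α) (f : α → α) : Prop :=
  (∀ b ∈ B ∩ T, Q.Adj b (f b)) ∧ ∀ a ∈ A, (Odd {b ∈ B ∩ T | f b = a}.ncard ↔ a ∈ T)

variable {Q : Graph α β} {T A B S : Set α} {F : Set β} {f : α → α}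

lemma HasColorClasses.link_mem (hQ : HasColorClasses Q A B) {e : β} {x y : α}
    (h : Q.IsLink e x y) (hx : x ∈ B) : y ∈ A := by
  rcases hQ.2.2 e x y h with h | h
  · exact (Set.disjoint_left.1 hQ.2.1 h.1 hx).elim
  · exact h.2

lemma HasColorClasses.ne_of_link (hQ : HasColorClasses Q A B) {e : β} {x y : α}
    (h : Q.IsLink e x y) : x ≠ y := by
  rintro rfl
  rcases hQ.2.2 e x x h with h | h
  · exact Set.disjoint_left.1 hQ.2.1 h.1 h.2
  · exact Set.disjoint_left.1 hQ.2.1 h.2 h.1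

/-- An edge has at most one end in the tooth set. -/
lemma HasColorClasses.tooth_unique (hQ : HasColorClasses Q A B) {e : β} {b b' x y : α}
    (h : Q.IsLink e b x) (h' : Q.IsLink e b' y) (hb : b ∈ B) (hb' : b' ∈ B) : b = b' := by
  rcases h.left_eq_or_eq h' with h1 | h1
  · exact h1
  · exact (Set.disjoint_left.1 hQ.2.1 (hQ.link_mem h' hb') (h1 ▸ hb)).elim

lemma HasColorClasses.mem_edgeCut_iff (hQ : HasColorClasses Q A B) {e : β} {v : α} :
    e ∈ edgeCut Q {v} ↔ ∃ y, Q.IsLink e v y := by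
  constructor
  · rintro ⟨x, rfl, y, -, h⟩
    exact ⟨y, h⟩
  · rintro ⟨y, h⟩
    exact ⟨v, rfl, y, ⟨h.right_mem, (hQ.ne_of_link h).symm⟩, h⟩

lemma HasColorClasses.edgeCut_spine (hQ : HasColorClasses Q A B) (hS : S ⊆ B) {g : α → β}
    (hg : ∀ b ∈ S, Q.IsLink (g b) b (f b)) {a : α} (ha : a ∈ A) :
    edgeCut Q {a} ∩ g '' S = g '' {b ∈ S | f b = a} := by
  ext e
  rw [Set.mem_inter_iff, hQ.mem_edgeCut_iff]
  constructor
  · rintro ⟨⟨y, h⟩, b, hb, rfl⟩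
    refine ⟨b, ⟨hb, ?_⟩, rfl⟩
    rcases h.left_eq_or_eq (hg b hb) with h1 | h1
    · exact (Set.disjoint_left.1 hQ.2.1 ha (h1 ▸ hS hb)).elim
    · exact h1.symm
  · rintro ⟨b, ⟨hb, rfl⟩, rfl⟩
    exact ⟨⟨b, (hg b hb).symm⟩, b, hb, rfl⟩

lemma HasColorClasses.injOn (hQ : HasColorClasses Q A B) (hS : S ⊆ B) {g : α → β}
    (hg : ∀ b ∈ S, Q.IsLink (g b) b (f b)) : Set.InjOn g S := by
  intro b hb b' hb' h
  have := hg b' hb'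
  rw [← h] at this
  exact hQ.tooth_unique (hg b hb) this (hS hb) (hS hb')

lemma HasColorClasses.edgeCut_tooth (hQ : HasColorClasses Q A B) (hS : S ⊆ B) {g : α → β}
    (hg : ∀ b ∈ S, Q.IsLink (g b) b (f b)) {b : α} (hb : b ∈ B) :
    Odd (edgeCut Q {b} ∩ g '' S).ncard ↔ b ∈ S := by
  by_cases hbS : b ∈ S
  · have : edgeCut Q {b} ∩ g '' S = {g b} := by
      ext e
      rw [Set.mem_inter_iff, hQ.mem_edgeCut_iff, Set.mem_singleton_iff]
      constructor
      · rintro ⟨⟨y, h⟩, b', hb', rfl⟩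
        rw [hQ.tooth_unique h (hg b' hb') hb (hS hb')]
      · rintro rfl
        exact ⟨⟨_, hg b hbS⟩, b, hbS, rfl⟩
    simp [this, hbS]
  · have : edgeCut Q {b} ∩ g '' S = ∅ := by
      ext e
      rw [Set.mem_inter_iff, hQ.mem_edgeCut_iff, Set.mem_empty_iff_false, iff_false]
      rintro ⟨⟨y, h⟩, b', hb', rfl⟩
      exact hbS (hQ.tooth_unique h (hg b' hb') hb (hS hb') ▸ hb')
    simp [this, hbS]

/-- Edges realizing a selection form a join with one edge for every terminal tooth. -/
lemma IsSelection.isJoin (hQ : HasColorClasses Q A B) (hf : IsSelection Q T A B f) {g : α → β}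
    (hg : ∀ b ∈ B ∩ T, Q.IsLink (g b) b (f b)) : IsJoin Q T (g '' (B ∩ T)) := by
  refine ⟨?_, fun v hv => ?_⟩
  · rintro _ ⟨b, hb, rfl⟩
    exact (hg b hb).edge_mem
  · rw [← hQ.1] at hv
    rcases hv with hv | hv
    · rw [hQ.edgeCut_spine Set.inter_subset_left hg hv, ← hf.2 v hv,
        ((hQ.injOn Set.inter_subset_left hg).mono (Set.sep_subset _ _)).ncard_image]
    · rw [hQ.edgeCut_tooth Set.inter_subset_left hg hv]
      exact ⟨fun h => h.2, fun h => ⟨hv, h⟩⟩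

lemma IsJoin.exists_edge (hQ : HasColorClasses Q A B) (hF : IsJoin Q T F) {b : α}
    (hb : b ∈ B ∩ T) : ∃ e ∈ F, ∃ y, Q.IsLink e b y := by
  have h1 := ((hF.2 b (hQ.1 ▸ Or.inr hb.1)).2 hb.2).pos
  obtain ⟨e, he, heF⟩ := Set.nonempty_of_ncard_ne_zero h1.ne'
  exact ⟨e, heF, hQ.mem_edgeCut_iff.1 he⟩

/-- A join contains distinct edges at the terminal teeth. -/
lemma IsJoin.exists_edges [Nonempty β] (hQ : HasColorClasses Q A B) (hF : IsJoin Q T F) :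
    ∃ (g : α → β) (f : α → α), (∀ b ∈ B ∩ T, Q.IsLink (g b) b (f b)) ∧ g '' (B ∩ T) ⊆ F := by
  have h : ∀ b : α, ∃ (e : β) (y : α), b ∈ B ∩ T → Q.IsLink e b y ∧ e ∈ F := by
    intro b
    by_cases hb : b ∈ B ∩ T
    · obtain ⟨e, he, y, hy⟩ := hF.exists_edge hQ hb
      exact ⟨e, y, fun _ => ⟨hy, he⟩⟩
    · exact ⟨Classical.arbitrary β, b, fun h => (hb h).elim⟩
  choose g f hgf using h
  refine ⟨g, f, fun b hb => (hgf b hb).1, ?_⟩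
  rintro _ ⟨b, hb, rfl⟩
  exact (hgf b hb).2

/-- Each terminal tooth has an edge in the join, and an edge has only one tooth. -/
lemma IsJoin.encard_le (hQ : HasColorClasses Q A B) (hF : IsJoin Q T F) :
    (B ∩ T).encard ≤ F.encard := by
  rcases (B ∩ T).eq_empty_or_nonempty with h | ⟨b, hb⟩
  · simp [h]
  · obtain ⟨e, -⟩ := hF.exists_edge hQ hb
    have : Nonempty β := ⟨e⟩
    obtain ⟨g, f, hg, hgF⟩ := hF.exists_edges hQ
    rw [← (hQ.injOn Set.inter_subset_left hg).encard_image]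
    exact Set.encard_le_encard hgF

/-- A join with as many edges as terminal teeth comes from a selection. -/
lemma IsJoin.exists_selection (hQ : HasColorClasses Q A B) (hfin : (B ∩ T).Finite)
    (hF : IsJoin Q T F) (hcard : F.encard = (B ∩ T).encard) :
    ∃ f, IsSelection Q T A B f ∧ ∀ e ∈ F, ∀ b ∈ B, ∀ a, Q.IsLink e b a → f b = a := by
  rcases isEmpty_or_nonempty β with hβ | hβ
  · have hT : B ∩ T = ∅ := by
      rw [Set.eq_empty_iff_forall_notMem]
      intro b hb
      obtain ⟨e, -⟩ := hF.exists_edge hQ hb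
      exact hβ.elim e
    refine ⟨id, ⟨fun b hb => by simp [hT] at hb, fun a ha => ?_⟩, fun e => hβ.elim e⟩
    rw [← hF.2 a (hQ.1 ▸ Or.inl ha), hT, Set.eq_empty_of_isEmpty (edgeCut Q {a} ∩ F)]
    simp
  · obtain ⟨g, f, hg, hgF⟩ := hF.exists_edges hQ
    have hinj := hQ.injOn Set.inter_subset_left hg
    have hFg : g '' (B ∩ T) = F := by
      refine (hfin.image g).eq_of_subset_of_encard_le hgF ?_
      rw [hinj.encard_image, hcard]
    subst hFg
    refine ⟨f, ⟨fun b hb => ⟨_, hg b hb⟩, fun a ha => ?_⟩, ?_⟩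
    · rw [← hF.2 a (hQ.1 ▸ Or.inl ha), hQ.edgeCut_spine Set.inter_subset_left hg ha,
        (hinj.mono (Set.sep_subset _ _)).ncard_image]
    · rintro _ ⟨b', hb', rfl⟩ b hb a h
      obtain rfl := hQ.tooth_unique h (hg b' hb') hb hb'.1
      exact (hg b hb').right_unique h

lemma IsSelection.exists_isJoin (hQ : HasColorClasses Q A B) (hf : IsSelection Q T A B f) :
    ∃ F, IsJoin Q T F ∧ F.encard ≤ (B ∩ T).encard ∧
      ∀ b ∈ B ∩ T, ∃ e ∈ F, Q.IsLink e b (f b) := by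
  rcases (B ∩ T).eq_empty_or_nonempty with h | ⟨b, hb⟩
  · refine ⟨∅, ⟨Set.empty_subset _, fun v hv => ?_⟩, by simp, by simp [h]⟩
    rw [← hQ.1] at hv
    rcases hv with hv | hv
    · rw [← hf.2 v hv, h]; simp
    · have : v ∉ T := fun hT => Set.notMem_empty v (h ▸ ⟨hv, hT⟩)
      simp [this]
  · obtain ⟨e, -⟩ := hf.1 b hb
    have : ∀ b : α, ∃ e : β, b ∈ B ∩ T → Q.IsLink e b (f b) := by
      intro c
      by_cases hc : c ∈ B ∩ T
      · obtain ⟨e, he⟩ := hf.1 c hc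
        exact ⟨e, fun _ => he⟩
      · exact ⟨e, fun h => (hc h).elim⟩
    choose g hg using this
    exact ⟨g '' (B ∩ T), hf.isJoin hQ hg, Set.encard_image_le _ _,
      fun c hc => ⟨g c, Set.mem_image_of_mem _ hc, hg c hc⟩⟩

lemma le_nu (hQ : HasColorClasses Q A B) : (B ∩ T).encard ≤ nu Q T :=
  le_iInf₂ fun _ hF => IsJoin.encard_le hQ hF

lemma exists_isJoin_of_nu (h : nu Q T ≠ ⊤) : ∃ F, IsJoin Q T F ∧ F.encard = nu Q T := by
  have e : nu Q T = sInf (Set.encard '' {F | IsJoin Q T F}) := by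
    rw [sInf_image]; rfl
  have hne : (Set.encard '' {F | IsJoin Q T F}).Nonempty := by
    by_contra hcon
    rw [Set.not_nonempty_iff_eq_empty] at hcon
    rw [e, hcon, sInf_empty] at h
    exact h rfl
  obtain ⟨F, hF, hF'⟩ := csInf_mem hne
  exact ⟨F, hF, hF'.trans e.symm⟩

/-- The lower bound on the size of a join by the number of terminal teeth is attained if and only
if there is a selection. -/
lemma nu_eq_iff (hQ : HasColorClasses Q A B) (hfin : (B ∩ T).Finite) :
    nu Q T = (B ∩ T).encard ↔ ∃ f, IsSelection Q T A B f := by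
  constructor
  · intro h
    obtain ⟨F, hF, hF'⟩ := exists_isJoin_of_nu (Q := Q) (T := T) (by
      rw [h]; exact (Set.encard_lt_top_iff.2 hfin).ne)
    obtain ⟨f, hf, -⟩ := hF.exists_selection hQ hfin (hF'.trans h)
    exact ⟨f, hf⟩
  · rintro ⟨f, hf⟩
    obtain ⟨F, hF, hle, -⟩ := hf.exists_isJoin hQ
    exact le_antisymm ((iInf₂_le F hF).trans hle) (le_nu hQ)

/-- The terminal teeth in `K` are counted by their images: modulo 2 this is the number of spine
vertices with an odd fiber, which are the terminal ones. So teeth and spine vertices contribute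
equal parities to `K ∩ T`. -/
lemma IsSelection.even_ncard (hQ : HasColorClasses Q A B) (hV : V(Q).Finite) (hT : T ⊆ V(Q))
    (hf : IsSelection Q T A B f) {K : Set α} (hKV : K ⊆ V(Q))
    (hK : ∀ b ∈ B ∩ T, b ∈ K ↔ f b ∈ K) : Even (K ∩ T).ncard := by
  have hKA : (K ∩ A).Finite := hV.subset (Set.inter_subset_left.trans hKV)
  have hKB : (K ∩ (B ∩ T)).Finite := hV.subset (Set.inter_subset_left.trans hKV)
  have hKAT : (K ∩ (A ∩ T)).Finite := hV.subset (Set.inter_subset_left.trans hKV)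
  have hsplit : K ∩ T = K ∩ (B ∩ T) ∪ K ∩ (A ∩ T) := by
    ext v
    have : v ∈ T → v ∈ A ∪ B := fun h => hQ.1 ▸ hT h
    simp only [Set.mem_inter_iff, Set.mem_union] at this ⊢
    tauto
  have hdis : Disjoint (K ∩ (B ∩ T)) (K ∩ (A ∩ T)) := by
    rw [Set.disjoint_left]
    exact fun v h h' => Set.disjoint_left.1 hQ.2.1 h'.2.1 h.2.1
  have hfib : hKB.toFinset.card =
      ∑ a ∈ hKA.toFinset, (hKB.toFinset.filter (fun b => f b = a)).card := by
    refine Finset.card_eq_sum_card_fiberwise fun b hb => ?_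
    simp only [Set.Finite.coe_toFinset] at hb ⊢
    obtain ⟨e, he⟩ := hf.1 b hb.2
    exact ⟨(hK b hb.2).1 hb.1, hQ.link_mem he hb.2.1⟩
  have hodd : Odd hKB.toFinset.card ↔ Odd hKAT.toFinset.card := by
    rw [hfib, Finset.odd_sum_iff_odd_card_odd]
    have : hKA.toFinset.filter (fun a => Odd (hKB.toFinset.filter (fun b => f b = a)).card) =
        hKAT.toFinset := by
      ext a
      simp only [Finset.mem_filter, Set.Finite.mem_toFinset, Set.mem_inter_iff, and_assoc]
      refine and_congr_right fun haK => and_congr_right fun haA => ?_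
      rw [← hf.2 a haA, ← Set.ncard_coe_finset]
      have : ((hKB.toFinset.filter (fun b => f b = a) : Finset α) : Set α) =
          {b ∈ B ∩ T | f b = a} := by
        ext b
        simp only [Finset.coe_filter, Set.Finite.mem_toFinset, Set.mem_inter_iff, Set.mem_ofPred_eq]
        constructor
        · exact fun h => ⟨h.1.2, h.2⟩
        · exact fun h => ⟨⟨(hK b h.1).2 (h.2 ▸ haK), h.1⟩, h.2⟩
      rw [this]
    rw [this]
  rw [hsplit, Set.ncard_union_eq hdis hKB hKAT, Set.ncard_eq_toFinset_card _ hKB,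
    Set.ncard_eq_toFinset_card _ hKAT, Nat.even_add, ← Nat.not_odd_iff_even,
    ← Nat.not_odd_iff_even, hodd]

lemma PathJoined.symm {D : Set β} {u v : α} (h : PathJoined Q D u v) : PathJoined Q D v u := by
  refine ⟨h.2.1, h.1, ?_⟩
  have := h.2.2
  clear h
  induction this with
  | refl => exact Relation.ReflTransGen.refl
  | tail _ h ih =>
    obtain ⟨e, he, h⟩ := h
    exact ih.head ⟨e, he, h.symm⟩

lemma PathJoined.trans {D : Set β} {u v w : α} (h : PathJoined Q D u v)
    (h' : PathJoined Q D v w) : PathJoined Q D u w :=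
  ⟨h.1, h'.2.1, h.2.2.trans h'.2.2⟩

lemma pathJoined_of_link {D : Set β} {e : β} {u v : α} (h : Q.IsLink e u v) (he : e ∈ D) :
    PathJoined Q D u v :=
  ⟨h.left_mem, h.right_mem, Relation.ReflTransGen.single ⟨e, he, h⟩⟩

lemma IsSelection.isGraft (hQ : HasColorClasses Q A B) (hV : V(Q).Finite) (hT : T ⊆ V(Q))
    (hf : IsSelection Q T A B f) : IsGraft Q T := by
  refine ⟨hT, fun v hv => hf.even_ncard hQ hV hT (fun u hu => hu.2.1) fun b hb => ?_⟩
  obtain ⟨e, he⟩ := hf.1 b hb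
  have := pathJoined_of_link he he.edge_mem
  exact ⟨fun h => h.trans this, fun h => h.trans this.symm⟩

/-- For a state, the number of teeth sent to a spine vertex. -/
lemma sum_pt_apply {U : Finset α} {a : α} :
    (∑ b ∈ U with b ∈ B, pt (f b)) a = (({b ∈ B ∩ U | f b = a}.ncard : ℕ) : ZMod 2) := by
  have : {b ∈ B ∩ (U : Set α) | f b = a} = (((U.filter (· ∈ B)).filter (fun b => f b = a) :
      Finset α) : Set α) := by
    ext b
    simp only [Set.mem_ofPred_eq, Set.mem_inter_iff, Finset.coe_filter, Finset.mem_coe,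
      Finset.mem_filter]
    tauto
  rw [this, Set.ncard_coe_finset, Finset.sum_apply, Finset.card_filter, Nat.cast_sum]
  refine Finset.sum_congr rfl fun b _ => ?_
  by_cases h : f b = a
  · simp [h]
  · simp [h, pt_of_ne (Ne.symm h)]

lemma isState_of {N : α → α → Prop} {U : Finset α} {z : α → ZMod 2} (hAB : Disjoint A B)
    (hU : ∀ v ∈ U, v ∈ A ∨ v ∈ B) (hz : ∀ v, v ∉ U → z v = 0)
    (hf : ∀ b ∈ U, b ∈ B → (f b = b ∧ z b = 1) ∨ (f b ∈ U ∧ f b ∈ A ∧ N b (f b) ∧ z b = 0))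
    (hcount : ∀ a ∈ U, a ∈ A → (({b ∈ B ∩ U | f b = a}.ncard : ℕ) : ZMod 2) =
      (if a ∈ T then 1 else 0) + z a) : IsState N A B T U f z := by
  refine ⟨fun b hb hB => ?_, funext fun v => ?_⟩
  · rcases hf b hb hB with h | h
    · exact Or.inl h.1
    · exact Or.inr ⟨h.1, h.2.1, h.2.2.1⟩
  · by_cases hv : v ∈ U
    · rcases hU v hv with hA | hB
      · rw [sum_pt_apply, hcount v hv hA]
        simp [Set.indicator, hA, hv]
      · have hA : v ∉ A := fun hA => Set.disjoint_left.1 hAB hA hB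
        rw [Finset.sum_apply, Pi.add_apply, Set.indicator_of_notMem (by simp [hA]), zero_add,
          Finset.sum_eq_single v]
        · rcases hf v hv hB with h | h
          · simp [h.1, h.2]
          · rw [h.2.2.2, pt_of_ne]
            rintro e
            exact hA (e ▸ h.2.1)
        · intro c hc hcv
          rw [Finset.mem_filter] at hc
          refine pt_of_ne ?_
          rintro rfl
          rcases hf c hc.1 hc.2 with h | h
          · exact hcv h.1.symm
          · exact hA h.2.1
        · exact fun h => (h (Finset.mem_filter.2 ⟨hv, hB⟩)).elim
    · rw [Finset.sum_apply, Pi.add_apply, Set.indicator_of_notMem (by simp [hv]), zero_add, hz v hv]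
      refine Finset.sum_eq_zero fun b hb => pt_of_ne ?_
      rintro rfl
      rw [Finset.mem_filter] at hb
      rcases hf b hb.1 hb.2 with h | h
      · exact hv (h.1.symm ▸ hb.1)
      · exact hv h.1

lemma IsState.count {N : α → α → Prop} {U : Finset α} {z : α → ZMod 2}
    (h : IsState N A B T U f z) {a : α} (ha : a ∈ U) (haA : a ∈ A) :
    (({b ∈ B ∩ U | f b = a}.ncard : ℕ) : ZMod 2) = (if a ∈ T then 1 else 0) + z a := by
  rw [← sum_pt_apply, h.2]
  simp [Set.indicator, ha, haA]

/-- Selections of an induced comb are its unmodified states. -/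
lemma isSelection_induce_iff {G : Graph α β} {U : Finset α} (hG : HasColorClasses G A B)
    (hBT : B ⊆ T) (hU : (U : Set α) ⊆ V(G)) :
    IsSelection (G.induce U) (T ∩ U) (A ∩ U) (B ∩ U) f ↔ IsState G.Adj A B T U f 0 := by
  have e : B ∩ U ∩ (T ∩ U) = B ∩ (U : Set α) := by
    ext b
    have := @hBT b
    simp only [Set.mem_inter_iff]
    tauto
  have hpar : ∀ (n : ℕ) (a : α), a ∈ U →
      ((Odd n ↔ a ∈ T ∩ U) ↔ (n : ZMod 2) = (if a ∈ T then 1 else 0) + (0 : α → ZMod 2) a) := by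
    intro n a ha
    by_cases haT : a ∈ T
    · simp [haT, ha, ZMod.natCast_eq_one_iff_odd]
    · simp [haT, ZMod.natCast_eq_zero_iff_even]
  unfold IsSelection
  rw [e]
  constructor
  · rintro ⟨h1, h2⟩
    refine isState_of hG.2.1 (fun v hv => by rw [← Set.mem_union, hG.1]; exact hU hv) (fun _ _ => rfl) (fun b hb hB => ?_)
      (fun a ha hA => (hpar _ a ha).1 (h2 a ⟨hA, ha⟩))
    obtain ⟨ed, hed⟩ := h1 b ⟨hB, hb⟩
    rw [Graph.induce_isLink] at hed
    exact Or.inr ⟨hed.2.2, hG.link_mem hed.1 hB, ⟨ed, hed.1⟩, rfl⟩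
  · intro h
    refine ⟨fun b hb => ?_, fun a ha => (hpar _ a ha.2).2 (h.count ha.2 ha.1)⟩
    rcases h.1 b hb.2 hb.1 with h' | h'
    · have := (h.apply_tooth hG.2.1 hb.2 hb.1).2 h'
      simp at this
    · obtain ⟨ed, hed⟩ := h'.2.2
      exact ⟨ed, by rw [Graph.induce_isLink]; exact ⟨hed, hb.2, h'.1⟩⟩

lemma HasColorClasses.induce {G : Graph α β} (hG : HasColorClasses G A B) {U : Set α}
    (hU : U ⊆ V(G)) : HasColorClasses (G.induce U) (A ∩ U) (B ∩ U) := by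
  refine ⟨?_, hG.2.1.mono Set.inter_subset_left Set.inter_subset_left, fun e x y h => ?_⟩
  · rw [← Set.union_inter_distrib_right, hG.1, Graph.vertexSet_induce]
    exact Set.inter_eq_right.2 hU
  · rw [Graph.induce_isLink] at h
    rcases hG.2.2 e x y h.1 with h' | h'
    · exact Or.inl ⟨⟨h'.1, h.2.1⟩, h'.2, h.2.2⟩
    · exact Or.inr ⟨⟨h'.1, h.2.1⟩, h'.2, h.2.2⟩

end Selections

/-! ### Factor-components are the subgraphs induced by classes. -/

section FactorComponents

open scoped Classical

variable {α β : Type*} {G : Graph α β} {T A B : Set α} {V C U : Finset α}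

lemma isSelection_iff {f : α → α} (hG : HasColorClasses G A B) (hBT : B ⊆ T) (hT : T ⊆ V(G))
    (hV : (V : Set α) = V(G)) : IsSelection G T A B f ↔ IsState G.Adj A B T V f 0 := by
  rw [← isSelection_induce_iff hG hBT hV.subset, hV, Graph.induce_vertexSet,
    Set.inter_eq_left.2 hT, Set.inter_eq_left.2 (hBT.trans hT), Set.inter_eq_left.2]
  exact hG.1 ▸ Set.subset_union_left

lemma IsComb.inter_eq (hG : IsComb G T A B) : B ∩ T = B := Set.inter_eq_left.2 hG.2.1

lemma IsComb.finite_teeth (hG : IsComb G T A B) (hV : (V : Set α) = V(G)) : (B ∩ T).Finite := by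
  rw [hG.inter_eq]
  refine V.finite_toSet.subset ?_
  rw [hV, ← hG.1.2.1]
  exact Set.subset_union_right

lemma IsComb.feas (hG : IsComb G T A B) (hV : (V : Set α) = V(G)) :
    Feas G.Adj A B T V 0 := by
  obtain ⟨f, hf⟩ := (nu_eq_iff hG.1.2 (hG.finite_teeth hV)).1 (by rw [hG.inter_eq]; exact hG.2.2)
  exact ⟨f, (isSelection_iff hG.1.2 hG.2.1 hG.1.1.1 hV).1 hf⟩

lemma IsMinJoin.encard_eq {F : Set β} (hF : IsMinJoin G T F) : F.encard = nu G T :=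
  le_antisymm (le_iInf₂ hF.2) (iInf₂_le F hF.1)

/-- A minimum join has |B| edges, so it comes from a selection, which is a state. -/
lemma IsComb.allowedPair_of_mem (hG : IsComb G T A B) (hV : (V : Set α) = V(G)) {e : β} {b a : α}
    (he : e ∈ allowedEdges G T) (h : G.IsLink e b a) (hb : b ∈ B) :
    AllowedPair G.Adj A B T V b a := by
  obtain ⟨F, hF, heF⟩ := he
  obtain ⟨f, hf, hfF⟩ := hF.1.exists_selection hG.1.2 (hG.finite_teeth hV)
    (by rw [hF.encard_eq, hG.inter_eq]; exact hG.2.2)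
  refine ⟨?_, hb, f, (isSelection_iff hG.1.2 hG.2.1 hG.1.1.1 hV).1 hf, hfF e heF b hb a h⟩
  rw [← Finset.mem_coe, hV]
  exact h.left_mem

lemma IsComb.exists_mem_of_allowedPair (hG : IsComb G T A B) (hV : (V : Set α) = V(G)) {b a : α}
    (h : AllowedPair G.Adj A B T V b a) : ∃ e ∈ allowedEdges G T, G.IsLink e b a := by
  obtain ⟨-, hB, f, hf, rfl⟩ := h
  obtain ⟨F, hF, hle, hl⟩ :=
    ((isSelection_iff hG.1.2 hG.2.1 hG.1.1.1 hV).2 hf).exists_isJoin hG.1.2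
  obtain ⟨e, he, hel⟩ := hl b ⟨hB, hG.2.1 hB⟩
  refine ⟨e, ⟨F, ⟨hF, fun F' hF' => hle.trans (hF'.encard_le hG.1.2)⟩, he⟩, hel⟩

lemma IsComb.factorConnected_iff (hG : IsComb G T A B) (hV : (V : Set α) = V(G)) {u v : α} :
    FactorConnected G T u v ↔ u ∈ V ∧ v ∈ V ∧ Relation.ReflTransGen
      (fun x y => AllowedPair G.Adj A B T V x y ∨ AllowedPair G.Adj A B T V y x) u v := by
  have hm : ∀ x, x ∈ V ↔ x ∈ V(G) := fun x => by rw [← hV]; rfl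
  unfold FactorConnected PathJoined
  rw [hm, hm]
  refine and_congr_right fun _ => and_congr_right fun _ => 
    ⟨fun h => Relation.ReflTransGen.mono ?_ _ _ h, fun h => Relation.ReflTransGen.mono ?_ _ _ h⟩
  · rintro x y ⟨e, he, h⟩
    rcases hG.1.2.2.2 e x y h with h' | h'
    · exact Or.inr (hG.allowedPair_of_mem hV he h.symm h'.2)
    · exact Or.inl (hG.allowedPair_of_mem hV he h h'.1)
  · rintro x y (h | h)
    · exact hG.exists_mem_of_allowedPair hV h
    · obtain ⟨e, he, h⟩ := hG.exists_mem_of_allowedPair hV h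
      exact ⟨e, he, h.symm⟩

/-- The class of `v`. -/
lemma exists_isClass {N : α → α → Prop} (hAB : Disjoint A B) {v : α} (hv : v ∈ V) :
    ∃ C, IsClass N A B T V C ∧ v ∈ C := by
  set R := fun x y => AllowedPair N A B T V x y ∨ AllowedPair N A B T V y x with hR
  have hrev : ∀ x y, Relation.ReflTransGen R x y → Relation.ReflTransGen R y x := by
    intro x y h
    induction h with
    | refl => exact Relation.ReflTransGen.refl
    | tail _ h ih => exact ih.head h.symm
  refine ⟨V.filter (fun w => Relation.ReflTransGen R v w), ⟨⟨Finset.filter_subset _ _, ?_⟩,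
    ⟨v, ?_⟩, ?_⟩, ?_⟩
  · intro b a h
    simp only [Finset.mem_filter, h.1, (h.props hAB).1, true_and]
    exact ⟨fun h' => h'.tail (Or.inl h), fun h' => h'.tail (Or.inr h)⟩
  · simp [hv, Relation.ReflTransGen.refl]
  · intro x hx y hy
    exact (hrev _ _ (Finset.mem_filter.1 hx).2).trans (Finset.mem_filter.1 hy).2
  · simp [hv, Relation.ReflTransGen.refl]

lemma IsClass.isFactorConnectedSubgraft (hG : IsComb G T A B) (hV : (V : Set α) = V(G))
    (hC : IsClass G.Adj A B T V C) : IsFactorConnectedSubgraft G T (G.induce C) := by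
  have hCV : (C : Set α) ⊆ V(G) := hV ▸ Finset.coe_subset.2 hC.1.1
  refine ⟨Graph.induce_le hCV, ?_, ?_, ?_⟩
  · rw [Graph.vertexSet_induce]
    exact hC.2.1
  · obtain ⟨f, hf⟩ := hC.1.feas (hG.feas hV)
    rw [Graph.vertexSet_induce]
    refine IsSelection.isGraft (hG.1.2.induce hCV) ?_ ?_
      ((isSelection_induce_iff hG.1.2 hG.2.1 hCV).2 hf)
    · rw [Graph.vertexSet_induce]; exact C.finite_toSet
    · rw [Graph.vertexSet_induce]; exact Set.inter_subset_right
  · intro u hu v hv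
    rw [Graph.vertexSet_induce] at hu hv
    exact (hG.factorConnected_iff hV).2 ⟨hC.1.1 hu, hC.1.1 hv, hC.2.2 u hu v hv⟩

lemma exists_isClass_of_isFactorConnectedSubgraft (hG : IsComb G T A B) (hV : (V : Set α) = V(G))
    {H : Graph α β} (hH : IsFactorConnectedSubgraft G T H) :
    ∃ C, IsClass G.Adj A B T V C ∧ H ≤ G.induce C := by
  obtain ⟨hle, ⟨v, hv⟩, -, hconn⟩ := hH
  have hvV : v ∈ V := by
    rw [← Finset.mem_coe, hV]; exact hle.vertexSet_mono hv
  obtain ⟨C, hC, hvC⟩ := exists_isClass (N := G.Adj) (T := T) hG.1.2.2.1 hvV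
  have hHC : V(H) ⊆ C := fun w hw =>
    hC.1.mem_of_conn ((hG.factorConnected_iff hV).1 (hconn v hv w hw)).2.2 hvC
  refine ⟨C, hC, ?_, ?_⟩
  · rw [Graph.vertexSet_induce]; exact hHC
  · intro e x y h
    rw [Graph.induce_isLink]
    exact ⟨h.mono hle, hHC h.left_mem, hHC h.right_mem⟩

lemma IsClass.mem_factorComponents (hG : IsComb G T A B) (hV : (V : Set α) = V(G))
    (hC : IsClass G.Adj A B T V C) : G.induce C ∈ factorComponents G T := by
  refine ⟨hC.isFactorConnectedSubgraft hG hV, fun H hH hle => ?_⟩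
  obtain ⟨C', hC', hHC'⟩ := exists_isClass_of_isFactorConnectedSubgraft hG hV hH
  obtain ⟨v, hv⟩ := hC.2.1
  have hvC' : v ∈ C' := by
    have := (hle.trans hHC').vertexSet_mono
    rw [Graph.vertexSet_induce, Graph.vertexSet_induce] at this
    exact this hv
  rwa [hC.eq_of_mem hC' hv hvC']

/-- The factor-components of a comb are the subgraphs induced by the classes. -/
lemma exists_isClass_of_mem_factorComponents (hG : IsComb G T A B) (hV : (V : Set α) = V(G))
    {H : Graph α β} (hH : H ∈ factorComponents G T) :
    ∃ C, IsClass G.Adj A B T V C ∧ H = G.induce C := by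
  obtain ⟨C, hC, hle⟩ := exists_isClass_of_isFactorConnectedSubgraft hG hV hH.1
  exact ⟨C, hC, le_antisymm hle (hH.2 (hC.isFactorConnectedSubgraft hG hV) hle)⟩

lemma IsComb.isSeparating_iff (hG : IsComb G T A B) (hV : (V : Set α) = V(G)) {X : Set α} :
    IsSeparating G T X ↔ ∃ U, IsClosedUnder G.Adj A B T V U ∧ (U : Set α) = X := by
  constructor
  · rintro ⟨𝓗, h𝓗, rfl⟩
    have hsub : (⋃ H ∈ 𝓗, V(H)) ⊆ V := by
      rw [hV]
      exact Set.iUnion₂_subset fun H hH => (h𝓗 hH).1.1.vertexSet_mono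
    refine ⟨(V.finite_toSet.subset hsub).toFinset, ⟨?_, fun b a h => ?_⟩, by simp⟩
    · exact fun x hx => hsub ((Set.Finite.mem_toFinset _).1 hx)
    · simp only [Set.Finite.mem_toFinset, Set.mem_iUnion, exists_prop]
      refine exists_congr fun H => and_congr_right fun hH => ?_
      obtain ⟨C, hC, rfl⟩ := exists_isClass_of_mem_factorComponents hG hV (h𝓗 hH)
      rw [Graph.vertexSet_induce]
      exact hC.1.2 b a h
  · rintro ⟨U, hU, rfl⟩
    refine ⟨{H | ∃ C, IsClass G.Adj A B T V C ∧ C ⊆ U ∧ H = G.induce C}, ?_, ?_⟩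
    · rintro _ ⟨C, hC, -, rfl⟩
      exact hC.mem_factorComponents hG hV
    · ext x
      simp only [Set.mem_iUnion, exists_prop]
      constructor
      · intro hx
        obtain ⟨C, hC, hxC⟩ := exists_isClass (N := G.Adj) (T := T) hG.1.2.2.1 (hU.1 hx)
        exact ⟨_, ⟨C, hC, hC.subset_of_mem hU hxC hx, rfl⟩, by
          rw [Graph.vertexSet_induce]; exact hxC⟩
      · rintro ⟨_, ⟨C, hC, hCU, rfl⟩, hx⟩
        rw [Graph.vertexSet_induce] at hx
        exact hCU hx

end FactorComponents

/-! ### Critical quasicombs from contraction, in terms of states. -/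

section Contraction

open scoped Classical

variable {α β : Type*} {G : Graph α β} {T A B : Set α} {V C X : Finset α}

lemma contract_isLink {X C : Set α} {e : β} {u v : Option α} :
    (contract (G.induce X) C).IsLink e u v ↔ ∃ x y, G.IsLink e x y ∧ x ∈ X ∧ y ∈ X ∧
      ¬ (x ∈ C ∧ y ∈ C) ∧ collapse C x = u ∧ collapse C y = v := by
  simp only [contract, Graph.map_isLink, Relation.Map, Graph.deleteEdges_isLink,
    Graph.induce_isLink, Graph.edgeSet_induce, Set.mem_ofPred_eq]
  refine exists_congr fun x => exists_congr fun y => ⟨?_, ?_⟩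
  · rintro ⟨⟨⟨h, hx, hy⟩, hne⟩, hu, hv⟩
    exact ⟨h, hx, hy, fun hC => hne ⟨x, y, ⟨h, hx, hy⟩, hC⟩, hu, hv⟩
  · rintro ⟨h, hx, hy, hne, hu, hv⟩
    refine ⟨⟨⟨h, hx, hy⟩, ?_⟩, hu, hv⟩
    rintro ⟨x', y', ⟨h', -, -⟩, hx', hy'⟩
    rcases h.eq_and_eq_or_eq_and_eq h' with ⟨rfl, rfl⟩ | ⟨rfl, rfl⟩
    · exact hne ⟨hx', hy'⟩
    · exact hne ⟨hy', hx'⟩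

lemma collapse_eq_some {C : Set α} {v w : α} : collapse C v = some w ↔ v = w ∧ v ∉ C := by
  unfold collapse
  split_ifs with h <;> simp [h]

lemma collapse_eq_none {C : Set α} {v : α} : collapse C v = none ↔ v ∈ C := by
  unfold collapse
  split_ifs with h <;> simp [h]

lemma contract_adj_some {a b : α} :
    (contract (G.induce X) (C : Set α)).Adj (some a) (some b) ↔
      G.Adj a b ∧ a ∈ X \ C ∧ b ∈ X \ C := by
  simp only [Graph.Adj, contract_isLink, collapse_eq_some, Finset.mem_coe, Finset.mem_sdiff]
  constructor
  · rintro ⟨e, x, y, h, hx, hy, -, ⟨rfl, hxC⟩, rfl, hyC⟩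
    exact ⟨⟨e, h⟩, ⟨hx, hxC⟩, hy, hyC⟩
  · rintro ⟨⟨e, h⟩, ha, hb⟩
    exact ⟨e, a, b, h, ha.1, hb.1, fun h => ha.2 h.1, ⟨rfl, ha.2⟩, rfl, hb.2⟩

lemma contract_adj_none (hCX : C ⊆ X) {p : α} :
    (contract (G.induce X) (C : Set α)).Adj none (some p) ↔ p ∈ X \ C ∧ ∃ c ∈ C, G.Adj c p := by
  simp only [Graph.Adj, contract_isLink, collapse_eq_some, collapse_eq_none, Finset.mem_coe,
    Finset.mem_sdiff]
  constructor
  · rintro ⟨e, x, y, h, -, hy, -, hxC, rfl, hyC⟩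
    exact ⟨⟨hy, hyC⟩, x, hxC, e, h⟩
  · rintro ⟨hp, c, hc, e, h⟩
    exact ⟨e, c, p, h, hCX hc, hp.1, fun h => hp.2 h.2, hc, rfl, hp.2⟩

lemma vertexSet_contract (hCX : C ⊆ X) (hC : C.Nonempty) :
    V(contract (G.induce X) (C : Set α)) = insert none (some '' ((X \ C : Finset α) : Set α)) := by
  ext v
  have : v ∈ V(contract (G.induce X) (C : Set α)) ↔ ∃ x ∈ X, collapse (C : Set α) x = v := by
    simp [contract]
  rw [this]
  rcases v with _ | v
  · simp only [collapse_eq_none, Finset.mem_coe, Set.mem_insert_iff, true_or, iff_true]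
    obtain ⟨c, hc⟩ := hC
    exact ⟨c, hCX hc, hc⟩
  · simp only [collapse_eq_some, Finset.mem_coe, Set.mem_insert_iff, Set.mem_image, reduceCtorEq,
      false_or, Option.some.injEq, exists_eq_right, Finset.mem_sdiff]
    constructor
    · rintro ⟨x, hx, rfl, hxC⟩
      exact ⟨hx, hxC⟩
    · exact fun h => ⟨v, h.1, rfl, h.2⟩

/-- The contraction is bipartite with the contracted vertex as a tooth if and only if no spine
vertex of the contracted set has a neighbor outside. -/
lemma contract_hasColorClasses_iff (hG : HasColorClasses G A B) (hXV : (X : Set α) ⊆ V(G))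
    (hCX : C ⊆ X) (hC : C.Nonempty) :
    HasColorClasses (contract (G.induce X) (C : Set α)) (some '' (A ∩ (X \ C : Finset α)))
      (insert none (some '' (B ∩ (X \ C : Finset α)))) ↔
      ∀ a ∈ C, a ∈ A → ∀ b ∈ X \ C, b ∈ B → ¬ G.Adj b a := by
  constructor
  · rintro h a ha haA b hb hbB ⟨e, he⟩
    -- After contraction this edge would join the root, a tooth, to the tooth `b`.
    obtain ⟨e', h'⟩ := (contract_adj_none hCX).2 ⟨hb, a, ha, e, he.symm⟩
    rcases h.2.2 e' _ _ h' with h1 | h1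
    · simp at h1
    · obtain ⟨b', hb', he'⟩ := h1.2
      obtain rfl := Option.some.inj he'
      exact Set.disjoint_left.1 hG.2.1 hb'.1 hbB
  · intro h
    refine ⟨?_, ?_, fun e u v huv => ?_⟩
    · rw [vertexSet_contract hCX hC, Set.union_insert, ← Set.image_union,
        ← Set.union_inter_distrib_right, hG.1]
      congr 2
      refine Set.inter_eq_right.2 fun x hx => hXV ?_
      exact (Finset.mem_sdiff.1 hx).1
    · rw [Set.disjoint_left]
      rintro _ ⟨a, ha, rfl⟩ hb
      simp only [Set.mem_insert_iff, reduceCtorEq, false_or, Set.mem_image, Option.some.injEq,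
        exists_eq_right] at hb
      exact Set.disjoint_left.1 hG.2.1 ha.1 hb.1
    · rw [contract_isLink] at huv
      obtain ⟨x, y, hxy, hx, hy, hne, rfl, rfl⟩ := huv
      have hcol : ∀ w ∈ X, w ∉ C → collapse (C : Set α) w = some w ∧ w ∈ X \ C := fun w hw hwC =>
        ⟨collapse_eq_some.2 ⟨rfl, hwC⟩, Finset.mem_sdiff.2 ⟨hw, hwC⟩⟩
      have main : ∀ x ∈ X, ∀ y ∈ X, ¬ (x ∈ C ∧ y ∈ C) → G.IsLink e x y → x ∈ A → y ∈ B →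
          collapse (C : Set α) x ∈ some '' (A ∩ ((X \ C : Finset α) : Set α)) ∧
          collapse (C : Set α) y ∈ insert none (some '' (B ∩ ((X \ C : Finset α) : Set α))) := by
        intro x hx y hy hne hxy hxA hyB
        have hxC : x ∉ C := by
          intro hxC
          have hyC : y ∉ C := fun hyC => hne ⟨hxC, hyC⟩
          exact h x hxC hxA y (hcol y hy hyC).2 hyB ⟨e, hxy.symm⟩
        refine ⟨⟨x, ⟨hxA, (hcol x hx hxC).2⟩, (hcol x hx hxC).1.symm⟩, ?_⟩
        by_cases hyC : y ∈ C
        · exact Or.inl (collapse_eq_none.2 hyC)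
        · exact Or.inr ⟨y, ⟨hyB, (hcol y hy hyC).2⟩, (hcol y hy hyC).1.symm⟩
      rcases hG.2.2 e x y hxy with h' | h'
      · exact Or.inl (main x hx y hy hne hxy h'.1 h'.2)
      · have := main y hy x hx (fun hC => hne hC.symm) hxy.symm h'.2 h'.1
        exact Or.inr this.symm

lemma IsClass.even_ncard (hG : IsComb G T A B) (hV : (V : Set α) = V(G))
    (hC : IsClass G.Adj A B T V C) : Even ((C : Set α) ∩ T).ncard := by
  obtain ⟨f, hf⟩ := hG.feas hV
  refine ((isSelection_iff hG.1.2 hG.2.1 hG.1.1.1 hV).2 hf).even_ncard hG.1.2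
    (hV ▸ V.finite_toSet) hG.1.1.1 (hV ▸ Finset.coe_subset.2 hC.1.1) fun b hb => ?_
  refine hC.1.2 b (f b) ⟨?_, hb.1, f, hf, rfl⟩
  rw [← Finset.mem_coe, hV]
  exact hG.1.1.1 hb.2

/-- A class has an even number of terminals, so the contracted vertex is a nonterminal tooth. It
becomes terminal only when the terminal set is modified by {x, root}. -/
lemma IsClass.contractTerminals_eq (hG : IsComb G T A B) (hV : (V : Set α) = V(G))
    (hC : IsClass G.Adj A B T V C) (hCX : C ⊆ X) :
    contractTerminals (T ∩ X) (C : Set α) = some '' (T ∩ (X \ C : Finset α)) := by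
  have h1 : (C : Set α) ∩ (T ∩ X) = (C : Set α) ∩ T := by
    ext x
    have := @hCX x
    simp only [Set.mem_inter_iff, Finset.mem_coe]
    tauto
  have h2 : (T ∩ (X : Set α)) \ C = T ∩ ((X \ C : Finset α) : Set α) := by
    ext x
    simp only [Set.mem_inter_iff, Set.mem_sdiff, Finset.mem_coe, Finset.mem_sdiff]
    tauto
  rw [contractTerminals, h1, h2]
  have : ¬ Odd ((C : Set α) ∩ T).ncard := Nat.not_odd_iff_even.2 (hC.even_ncard hG hV)
  simp [this]

/-- The root is not terminal, so the value of `Option.map f` at `none` plays no role. -/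
lemma contract_isSelection {U : Finset α} (hU : U = X \ C) (hG : HasColorClasses G A B)
    (hBT : B ⊆ T) {f : α → α} (hf : IsState G.Adj A B T U f 0) :
    IsSelection (contract (G.induce X) (C : Set α)) (some '' (T ∩ U)) (some '' (A ∩ U))
      (insert none (some '' (B ∩ U))) (Option.map f) := by
  have hS : insert none (some '' (B ∩ (U : Set α))) ∩ some '' (T ∩ (U : Set α)) =
      some '' (B ∩ (U : Set α)) := by
    ext v
    rcases v with _ | v
    · simp
    · have := @hBT v
      simp only [Set.mem_inter_iff, Set.mem_insert_iff, reduceCtorEq, false_or, Set.mem_image,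
        Option.some.injEq, exists_eq_right]
      tauto
  unfold IsSelection
  rw [hS]
  refine ⟨?_, ?_⟩
  · rintro _ ⟨b, ⟨hB, hb⟩, rfl⟩
    rcases hf.1 b hb hB with h | h
    · have := (hf.apply_tooth hG.2.1 hb hB).2 h
      simp at this
    · rw [Option.map_some, contract_adj_some, ← hU]
      exact ⟨h.2.2, hb, h.1⟩
  · rintro _ ⟨a, ⟨hA, ha⟩, rfl⟩
    have e : {b ∈ some '' (B ∩ (U : Set α)) | Option.map f b = some a} =
        some '' {b ∈ B ∩ (U : Set α) | f b = a} := by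
      ext v
      rcases v with _ | v <;> simp
    rw [e, (Option.some_injective α).injOn.ncard_image]
    have := hf.count ha hA
    by_cases haT : a ∈ T
    · simpa [haT, ZMod.natCast_eq_one_iff_odd, show a ∈ U from ha] using this
    · simpa [haT, ZMod.natCast_eq_zero_iff_even] using this

/-- The terminal teeth of the contraction after modifying the terminal set by `x` and the root. -/
lemma contract_teeth_inter {U : Finset α} (hBT : B ⊆ T) {x : α} :
    insert none (some '' (B ∩ (U : Set α))) ∩ ((some '' (T ∩ (U : Set α))) ∆ {some x, none}) =
      insert none (some '' {b ∈ B ∩ (U : Set α) | b ≠ x}) := by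
  ext v
  rcases v with _ | v
  · simp [Set.mem_symmDiff]
  · have := @hBT v
    simp only [Set.mem_inter_iff, Set.mem_insert_iff, reduceCtorEq, false_or, Set.mem_image,
      Option.some.injEq, exists_eq_right, Set.mem_symmDiff, Set.mem_singleton_iff, or_false,
      Set.mem_ofPred_eq]
    tauto

lemma ncard_insert_none {S : Set α} (hS : S.Finite) (h : Option α → Option α) (a : α) :
    {b ∈ insert none (some '' S) | h b = some a}.ncard =
      {b ∈ S | h (some b) = some a}.ncard + if h none = some a then 1 else 0 := by
  have hfin : (some '' {b ∈ S | h (some b) = some a}).Finite :=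
    (hS.subset (Set.sep_subset _ _)).image _
  by_cases hn : h none = some a
  · have e : {b ∈ insert none (some '' S) | h b = some a} =
        insert none (some '' {b ∈ S | h (some b) = some a}) := by
      ext v
      rcases v with _ | v <;> simp [hn]
    rw [e, Set.ncard_insert_of_notMem (by simp) hfin, (Option.some_injective α).injOn.ncard_image,
      if_pos hn]
  · have e : {b ∈ insert none (some '' S) | h b = some a} =
        some '' {b ∈ S | h (some b) = some a} := by
      ext v
      rcases v with _ | v <;> simp [hn]
    rw [e, (Option.some_injective α).injOn.ncard_image, if_neg hn, add_zero]

/-- Selections of the contraction whose terminal set is modified by `x` and the root correspond to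
states modified by `x` and a neighbor of the contracted set. -/
lemma contract_exists_isSelection_iff {U : Finset α} (hU : U = X \ C) (hG : HasColorClasses G A B)
    (hBT : B ⊆ T) (hXV : (X : Set α) ⊆ V(G)) (hCX : C ⊆ X)
    (hQ : HasColorClasses (contract (G.induce X) (C : Set α)) (some '' (A ∩ U))
      (insert none (some '' (B ∩ U)))) {x : α} (hx : x ∈ U) :
    (∃ h, IsSelection (contract (G.induce X) (C : Set α)) ((some '' (T ∩ U)) ∆ {some x, none})
      (some '' (A ∩ U)) (insert none (some '' (B ∩ U))) h) ↔
      ∃ p ∈ U, p ∈ A ∧ ∃ c ∈ C, c ∈ B ∧ G.Adj c p ∧ Feas G.Adj A B T U (pt x + pt p) := by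
  have hUAB : ∀ v ∈ U, v ∈ A ∨ v ∈ B := by
    intro v hv
    rw [← Set.mem_union, hG.1]
    rw [hU] at hv
    exact hXV (Finset.mem_sdiff.1 hv).1
  have hfinS : {b ∈ B ∩ (U : Set α) | b ≠ x}.Finite :=
    U.finite_toSet.subset fun b hb => hb.1.2
  have hne : ∀ v ∈ A, ∀ w ∈ B, v ≠ w := by
    rintro v hv _ hw rfl; exact Set.disjoint_left.1 hG.2.1 hv hw
  have hmemT : ∀ a : α, a ∈ U → (some a ∈ (some '' (T ∩ (U : Set α))) ∆ {some x, none} ↔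
      ((if a ∈ T then 1 else 0) + pt x a : ZMod 2) = 1) := by
    intro a ha
    by_cases haT : a ∈ T <;> by_cases hax : a = x <;>
      simp [Set.mem_symmDiff, haT, hax, show a ∈ U from ha, pt]
    all_goals first | decide | (subst hax; simp_all; try decide)
  -- Parity bookkeeping: the root, sent to `p`, adds one hit at `p` and nowhere else, which is the
  -- summand `pt p a` of the modification.
  have hpar : ∀ (n : ℕ) (a p : α) (P Q : Prop) [Decidable P], (P ↔ a = p) → ∀ t : ZMod 2,
      (Q ↔ t = 1) → ((Odd (n + if P then 1 else 0) ↔ Q) ↔ (n : ZMod 2) = t + pt p a) := by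
    intro n a p P Q _ hP t hQ
    rw [hQ, ← ZMod.natCast_eq_one_iff_odd, Nat.cast_add]
    have : ((if P then 1 else 0 : ℕ) : ZMod 2) = pt p a := by
      by_cases h : a = p <;> simp [hP, h, pt]
    rw [this]
    generalize (n : ZMod 2) = n'
    generalize pt p a = q
    clear hQ
    revert n' q t
    decide
  set S : Set α := {b ∈ B ∩ (U : Set α) | b ≠ x} with hS
  unfold IsSelection
  rw [contract_teeth_inter hBT]
  constructor
  · rintro ⟨h, h1, h2⟩
    obtain ⟨e, he⟩ := h1 none (Set.mem_insert _ _)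
    obtain ⟨p, ⟨hpA, hpU⟩, hp⟩ := hQ.link_mem he (Set.mem_insert _ _)
    have hadj := (contract_adj_none (G := G) hCX).1 ⟨e, hp ▸ he⟩
    obtain ⟨c, hc, e', hcp⟩ := hadj.2
    have hcB : c ∈ B := by
      rcases hG.2.2 e' c p hcp with h' | h'
      · exact (hne p hpA p h'.2 rfl).elim
      · exact h'.1
    have hval : ∀ b ∈ S, ∃ a ∈ U, a ∈ A ∧ h (some b) = some a ∧ G.Adj b a := by
      intro b hb
      have hb' : some b ∈ insert none (some '' S) := Or.inr ⟨b, hb, rfl⟩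
      obtain ⟨e, he⟩ := h1 _ hb'
      obtain ⟨a, ⟨haA, haU⟩, ha⟩ := hQ.link_mem he (Or.inr ⟨b, hb.1, rfl⟩)
      exact ⟨a, haU, haA, ha.symm, ((contract_adj_some (G := G)).1 ⟨e, ha ▸ he⟩).1⟩
    -- `x` is left unassigned, which matters only if it is a tooth; the default in `getD` is never
    -- reached on `S`.
    set f : α → α := fun b => if b = x then x else (h (some b)).getD b with hf
    have hfx : f x = x := by simp [hf]
    have hfS : ∀ b ∈ S, ∀ a, f b = a ↔ h (some b) = some a := by
      intro b hb a
      obtain ⟨a', -, -, ha', -⟩ := hval b hb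
      simp [hf, hb.2, ha']
    refine ⟨p, hpU, hpA, c, hc, hcB, ⟨e', hcp⟩, f, isState_of hG.2.1 hUAB ?_ ?_ ?_⟩
    · intro v hv
      have hvx : v ≠ x := by rintro rfl; exact hv hx
      have hvp : v ≠ p := by rintro rfl; exact hv hpU
      simp [pt_of_ne hvx, pt_of_ne hvp]
    · intro b hb hB
      have hbp := (hne p hpA b hB).symm
      by_cases hbx : b = x
      · subst hbx
        exact Or.inl ⟨hfx, by simp [pt_of_ne hbp]⟩
      · obtain ⟨a, haU, haA, ha, hadj⟩ := hval b ⟨⟨hB, hb⟩, hbx⟩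
        have := (hfS b ⟨⟨hB, hb⟩, hbx⟩ a).2 ha
        rw [this]
        exact Or.inr ⟨haU, haA, hadj, by simp [pt_of_ne hbx, pt_of_ne hbp]⟩
    · intro a ha hA
      have e : {b ∈ B ∩ (U : Set α) | f b = a} = {b ∈ S | h (some b) = some a} := by
        ext b
        constructor
        · rintro ⟨hb, hba⟩
          have hbx : b ≠ x := by
            rintro rfl
            rw [hfx] at hba
            exact hne a hA b hb.1 hba.symm
          exact ⟨⟨hb, hbx⟩, (hfS b ⟨hb, hbx⟩ a).1 hba⟩
        · rintro ⟨hb, hba⟩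
          exact ⟨hb.1, (hfS b hb a).2 hba⟩
      rw [e, Pi.add_apply, ← add_assoc]
      have h3 := h2 (some a) ⟨a, ⟨hA, ha⟩, rfl⟩
      rw [ncard_insert_none hfinS] at h3
      exact (hpar _ a p (h none = some a) _ (by rw [← hp]; simp [eq_comm]) _ (hmemT a ha)).1 h3
  · rintro ⟨p, hp, hpA, c, hc, hcB, hcp, f, hf⟩
    have hfx : x ∈ B → f x = x := fun hxB =>
      (hf.apply_tooth hG.2.1 hx hxB).1 (by simp [pt_of_ne (hne p hpA x hxB).symm])
    refine ⟨fun o => o.elim (some p) (fun b => some (f b)), ?_, ?_⟩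
    · rintro _ (rfl | ⟨b, hb, rfl⟩)
      · exact (contract_adj_none hCX).2 ⟨hU ▸ hp, c, hc, hcp⟩
      · rcases hf.1 b hb.1.2 hb.1.1 with h | h
        · have := (hf.apply_tooth hG.2.1 hb.1.2 hb.1.1).2 h
          simp [pt_of_ne hb.2, pt_of_ne (hne p hpA b hb.1.1).symm] at this
        · exact contract_adj_some.2 ⟨h.2.2, hU ▸ hb.1.2, hU ▸ h.1⟩
    · rintro _ ⟨a, ⟨hA, ha⟩, rfl⟩
      rw [ncard_insert_none hfinS]
      refine (hpar _ a p (some p = some a) _ (by simp [eq_comm]) _ (hmemT a ha)).2 ?_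
      have e : {b ∈ B ∩ (U : Set α) | f b = a} =
          {b ∈ S | Option.elim (some b) (some p) (fun b => some (f b)) = some a} := by
        ext b
        simp only [Option.elim_some, Option.some.injEq]
        constructor
        · rintro ⟨hb, hba⟩
          refine ⟨⟨hb, ?_⟩, hba⟩
          rintro rfl
          rw [hfx hb.1] at hba
          exact hne a hA b hb.1 hba.symm
        · rintro ⟨hb, hba⟩
          exact ⟨hb.1, hba⟩
      rw [← e, hf.count ha hA, Pi.add_apply, add_assoc]

/-- Critical sets in combinatorial form. -/
lemma IsClass.isCriticalSet_iff (hG : IsComb G T A B) (hV : (V : Set α) = V(G))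
    (hC : IsClass G.Adj A B T V C) :
    IsCriticalSet G T A B (G.induce C) X ↔ IsCriticalFor G.Adj A B T V C X := by
  unfold IsCriticalSet IsCriticalFor
  rw [hG.isSeparating_iff hV, Graph.vertexSet_induce, Finset.coe_subset]
  have hsep : (∃ U, IsClosedUnder G.Adj A B T V U ∧ (U : Set α) = X) ↔
      IsClosedUnder G.Adj A B T V X :=
    ⟨fun ⟨U, hU, h⟩ => Finset.coe_injective h ▸ hU, fun h => ⟨X, h, rfl⟩⟩
  rw [hsep]
  refine and_congr_right fun hX => and_congr_right fun hCX => ?_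
  have hXV : (X : Set α) ⊆ V(G) := hV ▸ Finset.coe_subset.2 hX.1
  rw [hC.contractTerminals_eq hG hV hCX]
  have hset : ∀ D : Set α, (D ∩ (X : Set α)) \ C = D ∩ ((X \ C : Finset α) : Set α) := by
    intro D
    ext v
    simp only [Set.mem_inter_iff, Set.mem_sdiff, Finset.mem_coe, Finset.mem_sdiff]
    tauto
  rw [hset, hset]
  have hcolor := contract_hasColorClasses_iff hG.1.2 hXV hCX hC.2.1
  obtain ⟨f, hf⟩ := (hX.sdiff hC.1).feas (hG.feas hV)
  have hsel := contract_isSelection rfl hG.1.2 hG.2.1 hf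
  have hiff := fun hQ x hx =>
    contract_exists_isSelection_iff (U := X \ C) (x := x) rfl hG.1.2 hG.2.1 hXV hCX hQ hx
  set U : Finset α := X \ C with hU
  set Q := contract (G.induce X) (C : Set α) with hQdef
  have hUfin : (B ∩ (U : Set α)).Finite := U.finite_toSet.subset Set.inter_subset_right
  have hB0 : insert none (some '' (B ∩ (U : Set α))) ∩ some '' (T ∩ (U : Set α)) =
      some '' (B ∩ (U : Set α)) := by
    ext v
    rcases v with _ | v
    · simp
    · have := @hG.2.1 v
      simp only [Set.mem_inter_iff, Set.mem_insert_iff, reduceCtorEq, false_or, Set.mem_image,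
        Option.some.injEq, exists_eq_right]
      tauto
  have hnu0 : HasColorClasses Q (some '' (A ∩ (U : Set α)))
      (insert none (some '' (B ∩ (U : Set α)))) →
      nu Q (some '' (T ∩ (U : Set α))) = (B ∩ (U : Set α)).encard := by
    intro hQ
    rw [(nu_eq_iff hQ ?_).2 ⟨_, hsel⟩, hB0, (Option.some_injective α).encard_image]
    rw [hB0]
    exact hUfin.image _
  -- The left-hand count is the number of terminal teeth after modification: those of `U` other than
  -- `x`, and the root. It is the lower bound for ν, attained exactly when a selection exists. For
  -- spine `x` it equals the old ν plus 1, for a tooth `x` the old ν, as criticality demands.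
  have hnu : ∀ x ∈ U, HasColorClasses Q (some '' (A ∩ (U : Set α)))
      (insert none (some '' (B ∩ (U : Set α)))) →
      (nu Q ((some '' (T ∩ (U : Set α))) ∆ {some x, none}) =
        {b ∈ B ∩ (U : Set α) | b ≠ x}.encard + 1 ↔
      ∃ p ∈ U, p ∈ A ∧ ∃ c ∈ C, c ∈ B ∧ G.Adj c p ∧ Feas G.Adj A B T U (pt x + pt p)) := by
    intro x hx hQ
    rw [← hiff hQ x hx, ← nu_eq_iff hQ, contract_teeth_inter hG.2.1,
      Set.encard_insert_of_notMem (by simp), (Option.some_injective α).encard_image]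
    rw [contract_teeth_inter hG.2.1]
    exact ((hUfin.subset (Set.sep_subset _ _)).image _).insert _
  have hcardA : ∀ x ∈ A, {b ∈ B ∩ (U : Set α) | b ≠ x} = B ∩ (U : Set α) := by
    intro x hx
    refine Set.sep_eq_self_iff_mem_true.2 fun b hb => ?_
    rintro rfl
    exact Set.disjoint_left.1 hG.1.2.2.1 hx hb.1
  have hcardB : ∀ x ∈ B ∩ (U : Set α), {b ∈ B ∩ (U : Set α) | b ≠ x}.encard + 1 =
      (B ∩ (U : Set α)).encard := by
    intro x hx
    exact Set.encard_sdiff_singleton_add_one hx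
  constructor
  · rintro ⟨⟨⟨-, hQ⟩, -⟩, -, hA, hB⟩
    refine ⟨hcolor.1 hQ, fun v hv => (hnu v hv hQ).1 ?_⟩
    have hvAB : v ∈ A ∨ v ∈ B := by
      rw [← Set.mem_union, hG.1.2.1]
      exact hXV (Finset.mem_sdiff.1 hv).1
    rcases hvAB with hvA | hvB
    · rw [hA (some v) ⟨v, ⟨hvA, hv⟩, rfl⟩, hnu0 hQ, hcardA v hvA]
    · rw [hB (some v) (Or.inr ⟨v, ⟨hvB, hv⟩, rfl⟩) (by simp), hnu0 hQ, hcardB v ⟨hvB, hv⟩]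
  · rintro ⟨hcol, hreach⟩
    have hQ := hcolor.2 hcol
    refine ⟨⟨⟨hsel.isGraft hQ ?_ ?_, hQ⟩, ?_⟩, Set.mem_insert _ _, ?_, ?_⟩
    · rw [vertexSet_contract hCX hC.2.1]
      exact ((Finset.finite_toSet _).image _).insert _
    · rw [vertexSet_contract hCX hC.2.1]
      exact (Set.image_mono Set.inter_subset_right).trans (Set.subset_insert _ _)
    · rw [hnu0 hQ, hB0, (Option.some_injective α).encard_image]
    · rintro _ ⟨x, hx, rfl⟩
      rw [(hnu x hx.2 hQ).2 (hreach x hx.2), hnu0 hQ, hcardA x hx.1]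
    · rintro _ (rfl | ⟨x, hx, rfl⟩) hne
      · exact (hne rfl).elim
      · rw [(hnu x hx.2 hQ).2 (hreach x hx.2), hnu0 hQ, hcardB x hx]

end Contraction

end Graft

/-! ### The partial order. -/

/-- For every finite comb, `⪯` is a partial order on the set of its factor-components. -/
theorem mainTheorem3 {α β : Type*} (G : Graph α β) (T A B : Set α)
    (hV : V(G).Finite) (hE : E(G).Finite) (hG : Graft.IsComb G T A B) :
    IsPartialOrder (Graft.factorComponents G T)
      (fun G₁ G₂ => Graft.CathedralLE G T A B G₁ G₂) := by
  classical
  have hV' : (hV.toFinset : Set α) = V(G) := hV.coe_toFinset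
  have h0 := hG.feas hV'
  have hAB := hG.1.2.2.1
  have hVAB : ∀ v ∈ hV.toFinset, v ∈ A ∨ v ∈ B := by
    intro v hv
    rw [← Set.mem_union, hG.1.2.1]
    exact hV.mem_toFinset.1 hv
  have key : ∀ C₁ C₂ : Finset α, Graft.IsClass G.Adj A B T hV.toFinset C₁ →
      (Graft.CathedralLE G T A B (G.induce C₁) (G.induce C₂) ↔
        ∃ X, Graft.IsCriticalFor G.Adj A B T hV.toFinset C₁ X ∧ C₂ ⊆ X) := by
    intro C₁ C₂ hC₁
    constructor
    · rintro ⟨X, hX, hC₂X⟩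
      obtain ⟨U, -, rfl⟩ := (hG.isSeparating_iff hV').1 hX.1
      rw [Graph.vertexSet_induce, Finset.coe_subset] at hC₂X
      exact ⟨U, (hC₁.isCriticalSet_iff hG hV').1 hX, hC₂X⟩
    · rintro ⟨X, hX, hC₂X⟩
      refine ⟨X, (hC₁.isCriticalSet_iff hG hV').2 hX, ?_⟩
      rw [Graph.vertexSet_induce]
      exact Finset.coe_subset.2 hC₂X
  refine { refl := ?_, trans := ?_, antisymm := ?_ }
  · rintro ⟨H, hH⟩
    obtain ⟨C, hC, rfl⟩ := Graft.exists_isClass_of_mem_factorComponents hG hV' hH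
    -- `C` is critical for itself: `C \ C` is empty, so the remaining conditions are vacuous.
    refine (key C C hC).2 ⟨C, ⟨hC.1, subset_rfl, ?_, ?_⟩, subset_rfl⟩ <;> simp
  · rintro ⟨H₁, hH₁⟩ ⟨H₂, hH₂⟩ ⟨H₃, hH₃⟩ h₁₂ h₂₃
    obtain ⟨C₁, hC₁, rfl⟩ := Graft.exists_isClass_of_mem_factorComponents hG hV' hH₁
    obtain ⟨C₂, hC₂, rfl⟩ := Graft.exists_isClass_of_mem_factorComponents hG hV' hH₂
    obtain ⟨C₃, hC₃, rfl⟩ := Graft.exists_isClass_of_mem_factorComponents hG hV' hH₃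
    obtain ⟨X, hX, hCX⟩ := (key C₁ C₂ hC₁).1 h₁₂
    obtain ⟨Y, hY, hCY⟩ := (key C₂ C₃ hC₂).1 h₂₃
    exact (key C₁ C₃ hC₁).2 ⟨X ∪ Y, hX.union hAB hVAB h0 hC₁ hCX hY,
      hCY.trans Finset.subset_union_right⟩
  · rintro ⟨H₁, hH₁⟩ ⟨H₂, hH₂⟩ h₁₂ h₂₁
    obtain ⟨C₁, hC₁, rfl⟩ := Graft.exists_isClass_of_mem_factorComponents hG hV' hH₁
    obtain ⟨C₂, hC₂, rfl⟩ := Graft.exists_isClass_of_mem_factorComponents hG hV' hH₂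
    obtain ⟨X, hX, hCX⟩ := (key C₁ C₂ hC₁).1 h₁₂
    obtain ⟨Y, hY, hCY⟩ := (key C₂ C₁ hC₂).1 h₂₁
    -- The union of the two critical sets is critical for both classes, so they coincide.
    have h₁ := hX.union hAB hVAB h0 hC₁ hCX hY
    have h₂ := hY.union hAB hVAB h0 hC₂ hCY hX
    rw [Finset.union_comm] at h₂
    obtain rfl := h₁.class_unique hAB hVAB h0 hC₁ hC₂ h₂
    rfl
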